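/- Let $\mathcal H$ be a Hilbert space of finite dimension $d\ge 1$, let $\mathcal D(\mathcal K)$ denote the set of density matrices on a finite-dimensional Hilbert space $\mathcal K$, and let $\rho\in\mathcal D(\mathcal H)$. *Mazzola--Sutter--Renner (MSR) almost i.i.d. states.* For $0\le r\le n$, a state $\rho_n\in\mathcal D(\mathcal H^{\otimes n})$ of a system $A_1\ldots A_n$ is a $\binom nr$-almost i.i.d. state in $\rho$ if there are a finite-dimensional Hilbert space $\mathcal H_E$, a purification $|\psi\rangle\in\mathcal H\otimes\mathcal H_E$ of $\rho$ (a unit vector with $\mathrm{Tr}_E|\psi\rangle\langle\psi|=\rho$) and a state $\hat\rho_n\in\mathcal D((\mathcal H\otimes\mathcal H_E)^{\otimes n})$ with $\mathrm{Tr}_{E_1\ldots E_n}\hat\rho_n=\rho_n$ such that (i) $U_\pi\hat\rho_nU_\pi^\dagger=\hat\rho_n$ for all $\pi\in S_n$, where $U_\pi$ permutes the $n$ pairs $(A_i,E_i)$, and (ii) $\mathrm{supp}(\hat\rho_n)\subseteq\mathrm{span}\{U_\pi(|\psi\rangle^{\otimes(n-r)}\otimes|\omega\rangle):\pi\in S_n,\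 |\omega\rangle\in(\mathcal H\otimes\mathcal H_E)^{\otimes r}\}$. A sequence $(\rho_n)_{n\ge1}$ of states $\rho_n\in\mathcal D(\mathcal H^{\otimes n})$ is an MSR almost i.i.d. source along $\rho$ if there are integers $0\le r_n\le n$ with $r_n=o(n)$ such that $\rho_n$ is a $\binom n{r_n}$-almost i.i.d. state in $\rho$ for every $n\ge1$. *Wasserstein almost i.i.d. states.* For $\sigma,\sigma'\in\mathcal D(\mathcal H^{\otimes n})$, the quantum $W_1$ distance $\|\sigma-\sigma'\|_{W_1}$ is the least value of $\sum_{i=1}^n c_i$ over all decompositions $\sigma-\sigma'=\sum_{i=1}^n c_i(\tau^{(i)}-\eta^{(i)})$ with $c_i\ge0$, $\tau^{(i)},\eta^{(i)}\in\mathcal D(\mathcal H^{\otimes n})$ and $\mathrm{Tr}_{A_i}\tau^{(i)}=\mathrm{Tr}_{A_i}\eta^{(i)}$. A state $\rho_n\in\mathcal D(\mathcal H^{\otimes n})$, $n\ge1$, is an $(n,\epsilon)$-Wasserstein almost i.i.d. state in $\rho$ if $\frac1n\|\rho_n-\rho^{\otimes n}\|_{W_1}\le\epsilon$, and a sequence $(\rho_n)_{n\ge1}$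 of such states is a Wasserstein almost i.i.d. source along $\rho$ if $\lim_{n\to\infty}\frac1n\|\rho_n-\rho^{\otimes n}\|_{W_1}=0$. **Statement.** Let $h_2(x)=-x\ln x-(1-x)\ln(1-x)$ (with $0\ln0=0$) be the binary entropy. 1. For all $n\ge1$ and $0\le r\le n$, every $\binom nr$-almost i.i.d. state $\rho_n\in\mathcal D(\mathcal H^{\otimes n})$ in $\rho$ is an $(n,\epsilon)$-Wasserstein almost i.i.d. state in $\rho$, with $$\epsilon=\sqrt{\frac{h_2(r/n)+(r/n)\ln(d-1)}{2}}+\frac rn,$$ where the term $(r/n)\ln(d-1)$ is read as $0$ if $d=1$. 2. Every MSR almost i.i.d. source along $\rho$ is a Wasserstein almost i.i.d. source along $\rho$. -/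

import Mathlib

open scoped ComplexOrder

/-! ### States on `ℂ^a`, `a` a finite index set

The Hilbert space `ℋ` of dimension `|a|` is `ℂ^a`; its `n`-fold tensor power is `ℂ^(Fin n → a)`, with
the product basis, and `ℋ_A ⊗ ℋ_E` is `ℂ^(a × e)`. Operators are matrices in these bases. -/

/-- Density matrices: positive semidefinite with unit trace. -/
def IsState {a : Type*} [Fintype a] (ρ : Matrix a a ℂ) : Prop :=
  ρ.PosSemidef ∧ ρ.trace = 1

/-- The operator `|ψ⟩⟨ψ|`. -/
def ketBra {a : Type*} (ψ : a → ℂ) : Matrix a a ℂ :=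
  Matrix.vecMulVec ψ (star ψ)

/-- The partial trace `Tr_E` of an operator on `A ⊗ E`. -/
def traceRight {a e : Type*} [Fintype e] (ρ : Matrix (a × e) (a × e) ℂ) : Matrix a a ℂ :=
  Matrix.of fun x y => ∑ z, ρ (x, z) (y, z)

/-- `ψ` is a unit vector of `A ⊗ E` with `Tr_E |ψ⟩⟨ψ| = ρ`. -/
def IsPurification {a e : Type*} [Fintype a] [Fintype e] (ψ : a × e → ℂ) (ρ : Matrix a a ℂ) :
    Prop :=
  ∑ x, ‖ψ x‖ ^ 2 = 1 ∧ traceRight (ketBra ψ) = ρ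

/-- The i.i.d. operator `ρ^{⊗ n}`. -/
def tensorPower {a : Type*} (n : ℕ) (ρ : Matrix a a ℂ) : Matrix (Fin n → a) (Fin n → a) ℂ :=
  Matrix.of fun x y => ∏ i, ρ (x i) (y i)

/-- The partial trace `Tr_{E^n}` of an operator on `(A ⊗ E)^{⊗ n}`. -/
def traceRightPower {a e : Type*} [Fintype e] {n : ℕ}
    (ρ : Matrix (Fin n → a × e) (Fin n → a × e) ℂ) : Matrix (Fin n → a) (Fin n → a) ℂ :=
  Matrix.of fun x y => ∑ z : Fin n → e, ρ (fun i => (x i, z i)) (fun i => (y i, z i))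

/-- The partial trace `Tr_{A_i}` over the `i`-th of `n` subsystems; the result is an operator on
the remaining ones. -/
def traceSite {a : Type*} [Fintype a] {n : ℕ} (i : Fin n)
    (ρ : Matrix (Fin n → a) (Fin n → a) ℂ) :
    Matrix ({j : Fin n // j ≠ i} → a) ({j : Fin n // j ≠ i} → a) ℂ :=
  Matrix.of fun x y =>
    ∑ s, ρ ((Equiv.funSplitAt i a).symm (s, x)) ((Equiv.funSplitAt i a).symm (s, y))

/-! ### Mazzola--Sutter--Renner almost i.i.d. states -/

/-- The unitary `U_π` on `(ℂ^b)^{⊗ n}` that permutes the tensor factors by `π`. -/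
def permUnitary {b : Type*} [DecidableEq b] {n : ℕ} (π : Equiv.Perm (Fin n)) :
    Matrix (Fin n → b) (Fin n → b) ℂ :=
  Matrix.of fun x y => if y = x ∘ π then 1 else 0

/-- `U_π ρ U_π† = ρ` for all permutations `π` of the tensor factors. -/
def IsPermInvariant {b : Type*} [Fintype b] [DecidableEq b] {n : ℕ}
    (ρ : Matrix (Fin n → b) (Fin n → b) ℂ) : Prop :=
  ∀ π : Equiv.Perm (Fin n), permUnitary π * ρ * (permUnitary π).conjTranspose = ρ

/-- The vector `|ψ⟩^{⊗ (n - r)} ⊗ |ω⟩` of `(ℂ^b)^{⊗ n}`, where `ω ∈ (ℂ^b)^{⊗ r}`. -/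
def withDefects {b : Type*} {n r : ℕ} (hr : r ≤ n) (ψ : b → ℂ) (ω : (Fin r → b) → ℂ) :
    (Fin n → b) → ℂ :=
  fun x => (∏ i : Fin (n - r), ψ (x ⟨i, by omega⟩)) * ω fun j => x ⟨n - r + j, by omega⟩

/-- The set `𝒱^n_r(ℂ^b, |ψ⟩)` of all vectors `U_π (|ψ⟩^{⊗ (n - r)} ⊗ |ω⟩)`. -/
def defectVectors {b : Type*} [Fintype b] [DecidableEq b] {n r : ℕ} (hr : r ≤ n) (ψ : b → ℂ) :
    Set ((Fin n → b) → ℂ) :=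
  {v | ∃ (π : Equiv.Perm (Fin n)) (ω : (Fin r → b) → ℂ),
    v = (permUnitary π).mulVec (withDefects hr ψ ω)}

/-- The `n`-partite state `ρn` is an `(n choose r)`-almost i.i.d. state in `ρ`: for some environment
`E = ℂ^m` of finite dimension, some purification `ψ` of `ρ` on `A ⊗ E` and some extension `τ` of
`ρn` to `(A ⊗ E)^{⊗ n}`, the state `τ` is invariant under permutations of the pairs `(A_i, E_i)` and
its support (its range, as it is self-adjoint) lies in the span of `𝒱^n_r(A ⊗ E, ψ)`. -/
def IsMSRAlmostIID {a : Type*} [Fintype a] [DecidableEq a] (n r : ℕ) (ρ : Matrix a a ℂ)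
    (ρn : Matrix (Fin n → a) (Fin n → a) ℂ) : Prop :=
  ∃ (hr : r ≤ n) (m : ℕ) (ψ : a × Fin m → ℂ)
    (τ : Matrix (Fin n → a × Fin m) (Fin n → a × Fin m) ℂ),
    IsPurification ψ ρ ∧ IsState τ ∧ traceRightPower τ = ρn ∧ IsPermInvariant τ ∧
      LinearMap.range τ.mulVecLin ≤ Submodule.span ℂ (defectVectors hr ψ)

/-- An MSR almost i.i.d. source along `ρ`: every `ρ_n` is `(n choose r_n)`-almost i.i.d. in `ρ`,
with `r_n = o(n)`. -/
def IsMSRSource {a : Type*} [Fintype a] [DecidableEq a] (ρ : Matrix a a ℂ)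
    (ρs : ∀ n : ℕ, Matrix (Fin n → a) (Fin n → a) ℂ) : Prop :=
  ∃ r : ℕ → ℕ, (fun n => (r n : ℝ)) =o[Filter.atTop] (fun n : ℕ => (n : ℝ)) ∧
    ∀ n : ℕ, 1 ≤ n → IsMSRAlmostIID n (r n) ρ (ρs n)

/-! ### The quantum Wasserstein distance of order 1 -/

/-- The values `∑ c_i` over all decompositions `ρ - σ = ∑ c_i (τ_i - η_i)` with `c_i ≥ 0` and states
`τ_i`, `η_i` such that `Tr_{A_i} τ_i = Tr_{A_i} η_i`. -/
def wassersteinCosts {a : Type*} [Fintype a] {n : ℕ}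
    (ρ σ : Matrix (Fin n → a) (Fin n → a) ℂ) : Set ℝ :=
  {w | ∃ (c : Fin n → ℝ) (τ η : Fin n → Matrix (Fin n → a) (Fin n → a) ℂ),
    (∀ i, 0 ≤ c i) ∧ (∀ i, IsState (τ i)) ∧ (∀ i, IsState (η i)) ∧
    (∀ i, traceSite i (τ i) = traceSite i (η i)) ∧
    ρ - σ = ∑ i, (c i : ℂ) • (τ i - η i) ∧ w = ∑ i, c i}

/-- The quantum `W₁` distance `‖ρ - σ‖_{W₁}` of two `n`-partite states. For states, the set of costs
is nonempty (`wassersteinCosts_nonempty`), and it is bounded below by `0`. -/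
noncomputable def wassersteinDist {a : Type*} [Fintype a] {n : ℕ}
    (ρ σ : Matrix (Fin n → a) (Fin n → a) ℂ) : ℝ :=
  sInf (wassersteinCosts ρ σ)

/-- `ρn` is an `(n, ε)`-almost i.i.d. state in `ρ` according to `W₁`. -/
def IsWassersteinAlmostIID {a : Type*} [Fintype a] (n : ℕ) (ε : ℝ) (ρ : Matrix a a ℂ)
    (ρn : Matrix (Fin n → a) (Fin n → a) ℂ) : Prop :=
  1 / (n : ℝ) * wassersteinDist ρn (tensorPower n ρ) ≤ ε

/-- A Wasserstein almost i.i.d. source along `ρ`. -/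
def IsWassersteinSource {a : Type*} [Fintype a] (ρ : Matrix a a ℂ)
    (ρs : ∀ n : ℕ, Matrix (Fin n → a) (Fin n → a) ℂ) : Prop :=
  Filter.Tendsto (fun n : ℕ => 1 / (n : ℝ) * wassersteinDist (ρs n) (tensorPower n ρ))
    Filter.atTop (nhds 0)

/-! ### The set of costs is nonempty -/

/-- Discard the `i`-th subsystem and replace it by the basis state `s₀`. -/
def resetSite {a : Type*} [Fintype a] [DecidableEq a] {n : ℕ} (s₀ : a) (i : Fin n)
    (ρ : Matrix (Fin n → a) (Fin n → a) ℂ) : Matrix (Fin n → a) (Fin n → a) ℂ :=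
  Matrix.diagonal (fun x : Fin n → a => if x i = s₀ then (1 : ℂ) else 0) *
    (traceSite i ρ).submatrix (fun x j => x j) (fun x j => x j) *
    (Matrix.diagonal (fun x : Fin n → a => if x i = s₀ then (1 : ℂ) else 0)).conjTranspose

theorem resetSite_apply {a : Type*} [Fintype a] [DecidableEq a] {n : ℕ} (s₀ : a) (i : Fin n)
    (ρ : Matrix (Fin n → a) (Fin n → a) ℂ) (x y : Fin n → a) :
    resetSite s₀ i ρ x y =
      if x i = s₀ ∧ y i = s₀ then traceSite i ρ (fun j => x j) (fun j => y j) else 0 := by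
  rw [resetSite, Matrix.diagonal_conjTranspose, Matrix.mul_diagonal, Matrix.diagonal_mul]
  by_cases h1 : x i = s₀ <;> by_cases h2 : y i = s₀ <;> simp [h1, h2]

theorem traceSite_resetSite {a : Type*} [Fintype a] [DecidableEq a] {n : ℕ} (s₀ : a) (i : Fin n)
    (ρ : Matrix (Fin n → a) (Fin n → a) ℂ) :
    traceSite i (resetSite s₀ i ρ) = traceSite i ρ := by
  ext x y
  have h (s : a) (z : {j : Fin n // j ≠ i} → a) :
      (fun j : {j : Fin n // j ≠ i} => (Equiv.funSplitAt i a).symm (s, z) j) = z := by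
    funext j; simp [Equiv.funSplitAt, Equiv.piSplitAt, j.2]
  have h' (s : a) (z : {j : Fin n // j ≠ i} → a) : (Equiv.funSplitAt i a).symm (s, z) i = s := by
    simp [Equiv.funSplitAt, Equiv.piSplitAt]
  conv_lhs => rw [traceSite]
  simp only [Matrix.of_apply, resetSite_apply, h, h', and_self]
  simp

theorem trace_traceSite {a : Type*} [Fintype a] {n : ℕ} (i : Fin n)
    (ρ : Matrix (Fin n → a) (Fin n → a) ℂ) : (traceSite i ρ).trace = ρ.trace := by
  classical
  simp only [Matrix.trace, Matrix.diag_apply, traceSite, Matrix.of_apply]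
  rw [← (Equiv.funSplitAt i a).symm.sum_comp (fun x => ρ x x), Fintype.sum_prod_type,
    Finset.sum_comm]

theorem IsState.resetSite {a : Type*} [Fintype a] [DecidableEq a] {n : ℕ} (s₀ : a) (i : Fin n)
    {ρ : Matrix (Fin n → a) (Fin n → a) ℂ} (h : IsState ρ) : IsState (resetSite s₀ i ρ) := by
  refine ⟨?_, ?_⟩
  · refine Matrix.PosSemidef.mul_mul_conjTranspose_same (Matrix.PosSemidef.submatrix ?_ _) _
    have : traceSite i ρ = ∑ s, ρ.submatrix (fun x => (Equiv.funSplitAt i a).symm (s, x))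
        (fun x => (Equiv.funSplitAt i a).symm (s, x)) := by
      ext x y; simp [traceSite, Matrix.sum_apply]
    rw [this]
    exact Matrix.posSemidef_sum _ fun s _ => h.1.submatrix _
  · rw [← trace_traceSite i, traceSite_resetSite, trace_traceSite, h.2]

/-- Reset the first `k` subsystems one after the other. -/
def resetFirst {a : Type*} [Fintype a] [DecidableEq a] {n : ℕ} (s₀ : a)
    (ρ : Matrix (Fin n → a) (Fin n → a) ℂ) : ℕ → Matrix (Fin n → a) (Fin n → a) ℂ
  | 0 => ρ
  | k + 1 => if h : k < n then resetSite s₀ ⟨k, h⟩ (resetFirst s₀ ρ k) else resetFirst s₀ ρ k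

theorem IsState.resetFirst {a : Type*} [Fintype a] [DecidableEq a] {n : ℕ} (s₀ : a)
    {ρ : Matrix (Fin n → a) (Fin n → a) ℂ} (h : IsState ρ) (k : ℕ) :
    IsState (resetFirst s₀ ρ k) := by
  induction k with
  | zero => exact h
  | succ k ih =>
    rw [_root_.resetFirst]
    split_ifs
    · exact ih.resetSite _ _
    · exact ih

theorem resetFirst_eq_zero {a : Type*} [Fintype a] [DecidableEq a] {n : ℕ} (s₀ : a)
    (ρ : Matrix (Fin n → a) (Fin n → a) ℂ) (k : ℕ) (x y : Fin n → a) (i : Fin n) (hi : i < k)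
    (h : x i ≠ s₀ ∨ y i ≠ s₀) : resetFirst s₀ ρ k x y = 0 := by
  induction k generalizing x y with
  | zero => omega
  | succ k ih =>
    rw [resetFirst]
    split_ifs with hk
    · rw [resetSite_apply]
      split_ifs with hs
      · have hne : i ≠ ⟨k, hk⟩ := by
          rintro rfl
          rcases h with h | h
          exacts [h hs.1, h hs.2]
        have hik : (i : ℕ) < k := by
          have : (i : ℕ) ≠ k := fun h => hne (Fin.ext h)
          omega
        rw [traceSite, Matrix.of_apply]
        refine Finset.sum_eq_zero fun s _ => ih _ _ hik ?_
        simpa [Equiv.funSplitAt, Equiv.piSplitAt, hne] using h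
      · rfl
    · exact ih _ _ (by omega) h

theorem resetFirst_eq {a : Type*} [Fintype a] [DecidableEq a] {n : ℕ} (s₀ : a)
    {ρ : Matrix (Fin n → a) (Fin n → a) ℂ} (h : IsState ρ) :
    resetFirst s₀ ρ n = Matrix.single (fun _ => s₀) (fun _ => s₀) 1 := by
  have key (x y : Fin n → a) (hxy : ¬ ((fun _ => s₀) = x ∧ (fun _ => s₀) = y)) :
      resetFirst s₀ ρ n x y = 0 := by
    by_contra hne
    refine hxy ⟨funext fun i => ?_, funext fun i => ?_⟩ <;> by_contra hi
    · exact hne (resetFirst_eq_zero s₀ ρ n x y i i.2 (Or.inl fun h => hi h.symm))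
    · exact hne (resetFirst_eq_zero s₀ ρ n x y i i.2 (Or.inr fun h => hi h.symm))
  ext x y
  rw [Matrix.single_apply]
  split_ifs with hxy
  · obtain ⟨rfl, rfl⟩ := hxy
    have ht := (h.resetFirst s₀ n).2
    simp only [Matrix.trace, Matrix.diag_apply] at ht
    rw [Finset.sum_eq_single (fun _ => s₀)
      (fun z _ hz => key z z fun hh => hz hh.1.symm)
      (fun hh => absurd (Finset.mem_univ _) hh)] at ht
    exact ht
  · exact key x y hxy

theorem IsState.average {a : Type*} [Fintype a] {ρ σ : Matrix a a ℂ} (hρ : IsState ρ)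
    (hσ : IsState σ) : IsState ((1 / 2 : ℂ) • (ρ + σ)) := by
  refine ⟨(hρ.1.add hσ.1).smul (by positivity), ?_⟩
  rw [Matrix.trace_smul, Matrix.trace_add, hρ.2, hσ.2]
  norm_num

theorem wassersteinCosts_nonempty {a : Type*} [Fintype a] {n : ℕ}
    {ρ σ : Matrix (Fin n → a) (Fin n → a) ℂ} (hρ : IsState ρ) (hσ : IsState σ) :
    (wassersteinCosts ρ σ).Nonempty := by
  classical
  by_cases hne : Nonempty a
  · obtain ⟨s₀⟩ := hne
    have hsite (τ : Matrix (Fin n → a) (Fin n → a) ℂ) (i : Fin n) :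
        traceSite i (resetFirst s₀ τ (i + 1)) = traceSite i (resetFirst s₀ τ i) := by
      rw [resetFirst, dif_pos i.2, traceSite_resetSite]
    have hlin (i : Fin n) (A B : Matrix (Fin n → a) (Fin n → a) ℂ) :
        traceSite i ((1 / 2 : ℂ) • (A + B)) = (1 / 2 : ℂ) • (traceSite i A + traceSite i B) := by
      ext x y
      simp only [traceSite, Matrix.of_apply, Matrix.smul_apply, Matrix.add_apply, smul_eq_mul,
        ← Finset.mul_sum, Finset.sum_add_distrib]
    refine ⟨_, fun _ => 2,
      fun i => (1 / 2 : ℂ) • (resetFirst s₀ ρ i + resetFirst s₀ σ (i + 1)),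
      fun i => (1 / 2 : ℂ) • (resetFirst s₀ ρ (i + 1) + resetFirst s₀ σ i),
      fun _ => by norm_num, fun i => (hρ.resetFirst _ _).average (hσ.resetFirst _ _),
      fun i => (hρ.resetFirst _ _).average (hσ.resetFirst _ _), fun i => ?_, ?_, rfl⟩
    · rw [hlin, hlin, hsite, hsite]
    · have h1 : ∑ i : Fin n, ((resetFirst s₀ ρ (i + 1) - resetFirst s₀ ρ i) -
          (resetFirst s₀ σ (i + 1) - resetFirst s₀ σ i)) = σ - ρ := by
        rw [Finset.sum_sub_distrib,
          Fin.sum_univ_eq_sum_range (fun i => resetFirst s₀ ρ (i + 1) - resetFirst s₀ ρ i) n,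
          Fin.sum_univ_eq_sum_range (fun i => resetFirst s₀ σ (i + 1) - resetFirst s₀ σ i) n,
          Finset.sum_range_sub, Finset.sum_range_sub, resetFirst_eq s₀ hρ, resetFirst_eq s₀ hσ]
        simp [resetFirst]
      rw [← neg_sub σ ρ, ← h1, ← Finset.sum_neg_distrib]
      refine Finset.sum_congr rfl fun i _ => ?_
      rw [← smul_sub, smul_smul]
      norm_num
      abel
  · rw [not_nonempty_iff] at hne
    rcases Nat.eq_zero_or_pos n with rfl | hn
    · refine ⟨0, 0, fun _ => 0, fun _ => 0, by simp, fun i => i.elim0, fun i => i.elim0,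
        fun i => i.elim0, ?_, by simp⟩
      have h1 := hρ.2
      have h2 := hσ.2
      simp only [Matrix.trace, Matrix.diag_apply, Finset.univ_unique, Finset.sum_singleton] at h1 h2
      ext x y
      rw [Subsingleton.elim x default, Subsingleton.elim y default]
      simp [h1, h2]
    · have : IsEmpty (Fin n → a) := ⟨fun x => hne.false (x ⟨0, hn⟩)⟩
      have := hρ.2
      simp [Matrix.trace] at this

/-! Put x = r/n, p = 1 - x, y = x/(d-1), and compare ρ_n first with σ^{⊗n}, where σ = y·1 + (p-y)ρ =
(1-x)ρ + x(1-ρ)/(d-1). Replacing σ by ρ one site at a time costs x per site, hence nx in total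
(`IsState.hasSiteCosts_tensorPower`). It remains to bound the distance from ρ_n to σ^{⊗n} by
n√(f/2), with f = h₂(x) + x ln(d-1).

The core is the operator inequality ρ_n ≤ K σ^{⊗n} with ln K = n f
(`IsMSRAlmostIID.posSemidef_sub`). On A ⊗ E let Y = y·1 + (p-y)|ψ⟩⟨ψ|. A unit vector v in the span
of the defect vectors only involves eigenvectors of Y^{⊗n} with at most r factors orthogonal to ψ,
whose eigenvalues are at least p^{n-r}y^r = 1/K; so |v⟩⟨v| ≤ K Y^{⊗n}. Tracing out E directly would
turn y·1 into y·dim(E)·1. Instead, both sides are tested on product vectors α ⊗ w, where w is the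
contraction of v with α. Conjugating w amounts to a partial transposition on E, and the partial
transpose of |ψ⟩⟨ψ| is dominated by Tr_E|ψ⟩⟨ψ| ⊗ 1. This leaves σ^{⊗n} on the A side, with no
dependence on E.

The operator inequality bounds the relative entropy by ln K (`IsLog.trace_mul_sub_le_log`). Marton's
inequality (`exists_hasSiteCosts_of_isLog`), which follows from the chain rule and Pinsker's
inequality, gives site costs with ∑ c_i² at most half the relative entropy, and Cauchy–Schwarz gives
∑ c_i ≤ √(n ln K / 2) = n√(f/2).

The argument needs y ≤ p, that is x ≤ 1 - 1/d. For larger x the trivial bound n on the distance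
suffices, since 1 - x ≤ √(h₂(x)/2) for x ≥ 1/2. The second claim holds because the bound is
continuous in x and vanishes at 0. -/

/-! ### Relative entropy of matrices given with their logarithms -/

/-- `H` is the logarithm of the positive definite matrix `A`: both are diagonal in a common
orthonormal basis, with eigenvalues `d i` and `exp (d i)`. -/
def IsLog {a : Type*} [Fintype a] [DecidableEq a] (A H : Matrix a a ℂ) : Prop :=
  ∃ (U : Matrix a a ℂ) (d : a → ℝ), U.conjTranspose * U = 1 ∧ U * U.conjTranspose = 1 ∧
    A = U * Matrix.diagonal (fun i => ((Real.exp (d i) : ℝ) : ℂ)) * U.conjTranspose ∧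
    H = U * Matrix.diagonal (fun i => ((d i : ℝ) : ℂ)) * U.conjTranspose

theorem Matrix.IsHermitian.exists_diagonalization {a : Type*} [Fintype a] [DecidableEq a]
    {A : Matrix a a ℂ} (hA : A.IsHermitian) :
    ∃ U : Matrix a a ℂ, U.conjTranspose * U = 1 ∧ U * U.conjTranspose = 1 ∧
      A = U * Matrix.diagonal (fun i => (hA.eigenvalues i : ℂ)) * U.conjTranspose := by
  refine ⟨hA.eigenvectorUnitary, ?_, ?_, ?_⟩
  · exact Unitary.coe_star_mul_self hA.eigenvectorUnitary
  · exact Unitary.coe_mul_star_self hA.eigenvectorUnitary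
  · conv_lhs => rw [hA.spectral_theorem, Unitary.conjStarAlgAut_apply]
    rfl

theorem Matrix.PosDef.exists_isLog {a : Type*} [Fintype a] [DecidableEq a] {A : Matrix a a ℂ}
    (hA : A.PosDef) : ∃ H, IsLog A H := by
  obtain ⟨U, h1, h2, h3⟩ := hA.isHermitian.exists_diagonalization
  refine ⟨_, U, fun i => Real.log (hA.isHermitian.eigenvalues i), h1, h2, ?_, rfl⟩
  have : ∀ i, Real.exp (Real.log (hA.isHermitian.eigenvalues i)) = hA.isHermitian.eigenvalues i :=
    fun i => Real.exp_log (hA.eigenvalues_pos i)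
  simp only [this]
  exact h3

theorem IsLog.posDef {a : Type*} [Fintype a] [DecidableEq a] {A H : Matrix a a ℂ}
    (h : IsLog A H) : A.PosDef := by
  obtain ⟨U, d, h1, h2, rfl, -⟩ := h
  have hU : IsUnit U := ⟨⟨U, U.conjTranspose, h2, h1⟩, rfl⟩
  refine (Matrix.IsUnit.posDef_star_right_conjugate_iff hU).2 ?_
  rw [Matrix.posDef_diagonal_iff]
  intro i
  exact_mod_cast Real.exp_pos _

/-! ### Traces as sums over pairs of eigenvalues, and Pinsker's inequality. -/

/-- Writes traces involving two non-commuting spectral decompositions over one index set, the pairs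
of eigenvectors, so that scalar inequalities can be applied termwise. -/
theorem trace_mul_diagonal_sandwich {a : Type*} [Fintype a] [DecidableEq a]
    (U V S T : Matrix a a ℂ) (f g : a → ℂ) :
    (U * Matrix.diagonal f * U.conjTranspose * S * (V * Matrix.diagonal g * V.conjTranspose) *
      T.conjTranspose).trace = ∑ i, ∑ j, f i * g j * (U.conjTranspose * S * V) i j *
        star ((U.conjTranspose * T * V) i j) := by
  have h : (U * Matrix.diagonal f * U.conjTranspose * S *
      (V * Matrix.diagonal g * V.conjTranspose) * T.conjTranspose).trace =
      (Matrix.diagonal f * (U.conjTranspose * S * V) * Matrix.diagonal g *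
        (U.conjTranspose * T * V).conjTranspose).trace := by
    have h1 : U * Matrix.diagonal f * U.conjTranspose * S *
        (V * Matrix.diagonal g * V.conjTranspose) * T.conjTranspose =
        U * (Matrix.diagonal f * U.conjTranspose * S *
          (V * Matrix.diagonal g * V.conjTranspose) * T.conjTranspose) := by
      simp only [Matrix.mul_assoc]
    rw [h1, Matrix.trace_mul_comm]
    simp only [Matrix.conjTranspose_mul, Matrix.conjTranspose_conjTranspose, Matrix.mul_assoc]
  rw [h, Matrix.trace]
  refine Finset.sum_congr rfl fun i _ => ?_
  rw [Matrix.diag_apply, Matrix.mul_apply]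
  refine Finset.sum_congr rfl fun j _ => ?_
  rw [Matrix.mul_diagonal, Matrix.diagonal_mul, Matrix.conjTranspose_apply]
  ring

/-- The difference of the two sides vanishes at 1 and has derivative (u-1)³/(u²(u+2)²). The bound is
a rearrangement of u ln u - u + 1 ≥ 3(u-1)²/(2(u+2)). -/
theorem Real.log_ge_pade {u : ℝ} (hu : 0 < u) :
    (5 * u ^ 2 - 4 * u - 1) / (2 * u ^ 2 + 4 * u) ≤ Real.log u := by
  let g : ℝ → ℝ := fun u => Real.log u - (5 * u ^ 2 - 4 * u - 1) / (2 * u ^ 2 + 4 * u)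
  have hd : ∀ u : ℝ, 0 < u → HasDerivAt g ((u - 1) ^ 3 / (u ^ 2 * (u + 2) ^ 2)) u := by
    intro u hu
    have h0 : 2 * u ^ 2 + 4 * u ≠ 0 := by positivity
    have h1 : HasDerivAt (fun u : ℝ => 5 * u ^ 2 - 4 * u - 1) (10 * u - 4) u := by
      have := (((hasDerivAt_pow 2 u).const_mul 5).sub ((hasDerivAt_id u).const_mul 4)).sub_const 1
      refine this.congr_deriv ?_
      norm_num
      ring
    have h2 : HasDerivAt (fun u : ℝ => 2 * u ^ 2 + 4 * u) (4 * u + 4) u := by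
      have := ((hasDerivAt_pow 2 u).const_mul 2).add ((hasDerivAt_id u).const_mul 4)
      refine this.congr_deriv ?_
      norm_num
      ring
    refine ((Real.hasDerivAt_log hu.ne').sub (h1.div h2 h0)).congr_deriv ?_
    field_simp
    ring
  have hg1 : g 1 = 0 := by simp only [g]; norm_num
  have key : g 1 ≤ g u := by
    rcases le_total u 1 with h | h
    · refine antitoneOn_of_deriv_nonpos (convex_Icc u 1)
        (fun v hv => (hd v (hu.trans_le hv.1)).continuousAt.continuousWithinAt)
        (fun v hv => ?_) (fun v hv => ?_) ⟨le_rfl, h⟩ ⟨h, le_rfl⟩ h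
      · rw [interior_Icc] at hv
        exact (hd v (hu.trans hv.1)).differentiableAt.differentiableWithinAt
      · rw [interior_Icc] at hv
        rw [(hd v (hu.trans hv.1)).deriv]
        refine div_nonpos_of_nonpos_of_nonneg ?_ (by positivity)
        exact Odd.pow_nonpos (by decide) (by linarith [hv.2])
    · refine monotoneOn_of_deriv_nonneg (convex_Icc 1 u)
        (fun v hv => (hd v (by linarith [hv.1])).continuousAt.continuousWithinAt)
        (fun v hv => ?_) (fun v hv => ?_) ⟨le_rfl, h⟩ ⟨h, le_rfl⟩ h
      · rw [interior_Icc] at hv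
        exact (hd v (by linarith [hv.1])).differentiableAt.differentiableWithinAt
      · rw [interior_Icc] at hv
        rw [(hd v (by linarith [hv.1])).deriv]
        have : 0 ≤ v - 1 := by linarith [hv.1]
        positivity
  rw [hg1] at key
  simp only [g] at key
  linarith

theorem klFun_ge_quadratic (x y : ℝ) :
    3 * (Real.exp x - Real.exp y) ^ 2 ≤
      2 * (2 * Real.exp y + Real.exp x) * (Real.exp x * (x - y) - Real.exp x + Real.exp y) := by
  have hu := Real.exp_pos (x - y)
  have h := Real.log_ge_pade hu
  rw [Real.log_exp, div_le_iff₀ (by positivity)] at h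
  have hx : Real.exp x = Real.exp (x - y) * Real.exp y := by rw [← Real.exp_add]; congr 1; ring
  rw [hx]
  set u := Real.exp (x - y)
  have hy := Real.exp_pos y
  have : 0 ≤ Real.exp y ^ 2 * ((x - y) * (2 * u ^ 2 + 4 * u) - (5 * u ^ 2 - 4 * u - 1)) :=
    mul_nonneg (by positivity) (by linarith)
  nlinarith [this]

/-- Completing the square in `z` reduces this to `klFun_ge_quadratic`. The weights 1/3 and 1/6 add
up to the 1/2 of Pinsker's inequality. -/
theorem klFun_mul_normSq_ge (x y : ℝ) (m z : ℂ) :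
    (Real.exp x - Real.exp y) * (z * star m).re -
        (Real.exp y / 3 + Real.exp x / 6) * Complex.normSq z ≤
      Complex.normSq m * (Real.exp x * (x - y) - Real.exp x + Real.exp y) := by
  have h := klFun_ge_quadratic x y
  have hx := Real.exp_pos x
  have hy := Real.exp_pos y
  set D := Real.exp x * (x - y) - Real.exp x + Real.exp y
  set w := 2 * Real.exp y + Real.exp x with hw
  have hw0 : 0 < w := by positivity
  set δ := Real.exp x - Real.exp y
  have hD : 3 * δ ^ 2 / (2 * w) ≤ D := by
    rw [div_le_iff₀ (by positivity)]; linarith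
  have hre : (z * star m).re = z.re * m.re + z.im * m.im := by
    simp [Complex.mul_re]
  rw [hre, Complex.normSq_apply, Complex.normSq_apply]
  have h1 : (m.re * m.re + m.im * m.im) * (3 * δ ^ 2 / (2 * w)) ≤
      (m.re * m.re + m.im * m.im) * D :=
    mul_le_mul_of_nonneg_left hD (by nlinarith [sq_nonneg m.re, sq_nonneg m.im])
  have h2 : (m.re * m.re + m.im * m.im) * (3 * δ ^ 2 / (2 * w)) -
      δ * (z.re * m.re + z.im * m.im) + w / 6 * (z.re * z.re + z.im * z.im) =
      ((3 * δ * m.re - w * z.re) ^ 2 + (3 * δ * m.im - w * z.im) ^ 2) / (6 * w) := by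
    field_simp
    ring
  have h3 : 0 ≤ ((3 * δ * m.re - w * z.re) ^ 2 + (3 * δ * m.im - w * z.im) ^ 2) / (6 * w) := by
    positivity
  have h4 : Real.exp y / 3 + Real.exp x / 6 = w / 6 := by rw [hw]; ring
  rw [h4]
  linarith

/-- Pinsker's inequality. -/
theorem IsLog.pinsker {a : Type*} [Fintype a] [DecidableEq a] {ρ σ H G S : Matrix a a ℂ}
    (hρ : IsLog ρ H) (hσ : IsLog σ G) (hρ1 : ρ.trace = 1) (hσ1 : σ.trace = 1)
    (hS : S.IsHermitian) (hS2 : S * S = 1) :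
    ((S * (ρ - σ)).trace.re) ^ 2 / 2 ≤ (ρ * (H - G)).trace.re := by
  obtain ⟨U, x, hU, hU', rfl, rfl⟩ := hρ
  obtain ⟨V, y, hV, hV', rfl, rfl⟩ := hσ
  set ρ := U * Matrix.diagonal (fun i => ((Real.exp (x i) : ℝ) : ℂ)) * U.conjTranspose with hρ
  set σ := V * Matrix.diagonal (fun i => ((Real.exp (y i) : ℝ) : ℂ)) * V.conjTranspose with hσ
  set H := U * Matrix.diagonal (fun i => ((x i : ℝ) : ℂ)) * U.conjTranspose with hH
  set G := V * Matrix.diagonal (fun i => ((y i : ℝ) : ℂ)) * V.conjTranspose with hG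
  set κ := (S * (ρ - σ)).trace.re with hκ
  set M := U.conjTranspose * 1 * V with hM
  set Z := U.conjTranspose * S * V with hZ
  have one_V : V * Matrix.diagonal (fun _ => (1 : ℂ)) * V.conjTranspose = 1 := by
    rw [Matrix.diagonal_one, Matrix.mul_one, hV']
  have one_U : U * Matrix.diagonal (fun _ => (1 : ℂ)) * U.conjTranspose = 1 := by
    rw [Matrix.diagonal_one, Matrix.mul_one, hU']
  have hρH : ρ * H = U * Matrix.diagonal (fun i => ((Real.exp (x i) * x i : ℝ) : ℂ)) *
      U.conjTranspose := by
    have : ρ * H = U * Matrix.diagonal (fun i => ((Real.exp (x i) : ℝ) : ℂ)) *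
      (U.conjTranspose * U) * Matrix.diagonal (fun i => ((x i : ℝ) : ℂ)) * U.conjTranspose := by
      simp only [hρ, hH, Matrix.mul_assoc]
    rw [this, hU, Matrix.mul_one, Matrix.mul_assoc U, Matrix.diagonal_mul_diagonal]
    simp only [Complex.ofReal_mul]
  have e1 : (ρ * H).trace = ∑ i, ∑ j, ((Real.exp (x i) * x i : ℝ) : ℂ) * 1 * M i j *
      star (M i j) := by
    rw [hM, ← trace_mul_diagonal_sandwich, one_V, hρH]
    simp
  have e2 : (ρ * G).trace = ∑ i, ∑ j, ((Real.exp (x i) : ℝ) : ℂ) * ((y j : ℝ) : ℂ) * M i j *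
      star (M i j) := by
    rw [hM, ← trace_mul_diagonal_sandwich]
    simp [hρ, hG]
  have e3 : (1 : ℂ) = ∑ i, ∑ j, ((Real.exp (x i) : ℝ) : ℂ) * 1 * M i j * star (M i j) := by
    rw [hM, ← trace_mul_diagonal_sandwich, one_V, ← hρ1]
    simp [hρ]
  have e4 : (1 : ℂ) = ∑ i, ∑ j, 1 * ((Real.exp (y j) : ℝ) : ℂ) * M i j * star (M i j) := by
    rw [hM, ← trace_mul_diagonal_sandwich, one_U, ← hσ1]
    simp [hσ]
  have e5 : (S * ρ).trace = ∑ i, ∑ j, ((Real.exp (x i) : ℝ) : ℂ) * 1 * Z i j * star (M i j) := by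
    rw [hM, hZ, ← trace_mul_diagonal_sandwich, one_V, Matrix.trace_mul_comm]
    simp [hρ]
  have e6 : (S * σ).trace = ∑ i, ∑ j, 1 * ((Real.exp (y j) : ℝ) : ℂ) * Z i j * star (M i j) := by
    rw [hM, hZ, ← trace_mul_diagonal_sandwich, one_U]
    simp [hσ]
  -- Since `S` is a Hermitian involution, inserting it between the eigenbases preserves both
  -- marginal normalisations: Tr(ρSS) = Tr(SσS) = 1.
  have e7 : (1 : ℂ) = ∑ i, ∑ j, ((Real.exp (x i) : ℝ) : ℂ) * 1 * Z i j * star (Z i j) := by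
    rw [hZ, ← trace_mul_diagonal_sandwich, one_V, hS.eq, Matrix.mul_one, Matrix.mul_assoc, hS2,
      Matrix.mul_one, ← hρ1]
  have e8 : (1 : ℂ) = ∑ i, ∑ j, 1 * ((Real.exp (y j) : ℝ) : ℂ) * Z i j * star (Z i j) := by
    rw [hZ, ← trace_mul_diagonal_sandwich, one_U, hS.eq, Matrix.one_mul, Matrix.trace_mul_comm,
      ← Matrix.mul_assoc, hS2, Matrix.one_mul, ← hσ1]
  -- The scalar inequality with m = M i j and z = κ · Z i j: the left side sums to κ² - κ²/2, the
  -- right side to the relative entropy.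
  have hsum : ∑ i, ∑ j, ((Real.exp (x i) - Real.exp (y j)) * ((κ * Z i j) * star (M i j)).re -
        (Real.exp (y j) / 3 + Real.exp (x i) / 6) * Complex.normSq (κ * Z i j)) ≤
      ∑ i, ∑ j, Complex.normSq (M i j) *
        (Real.exp (x i) * (x i - y j) - Real.exp (x i) + Real.exp (y j)) :=
    Finset.sum_le_sum fun i _ => Finset.sum_le_sum fun j _ => klFun_mul_normSq_ge _ _ _ _
  have ns : ∀ w : ℂ, (Complex.normSq w : ℂ) = w * star w := fun w =>
    Complex.normSq_eq_conj_mul_self.trans (mul_comm _ _)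
  have r1 := congrArg Complex.re e1
  have r2 := congrArg Complex.re e2
  have r3 := congrArg Complex.re e3
  have r4 := congrArg Complex.re e4
  have r5 := congrArg Complex.re e5
  have r6 := congrArg Complex.re e6
  have r7 := congrArg Complex.re e7
  have r8 := congrArg Complex.re e8
  simp only [mul_one, one_mul, mul_assoc, Complex.re_sum, ← ns, Complex.re_ofReal_mul,
    Complex.ofReal_re, Complex.one_re] at r1 r2 r3 r4 r5 r6 r7 r8
  have hL : ∑ i, ∑ j, ((Real.exp (x i) - Real.exp (y j)) * ((κ * Z i j) * star (M i j)).re -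
        (Real.exp (y j) / 3 + Real.exp (x i) / 6) * Complex.normSq (κ * Z i j)) =
      κ * (S * ρ).trace.re - κ * (S * σ).trace.re - κ ^ 2 / 2 := by
    have h12 : κ ^ 2 / 2 = κ ^ 2 / 3 * ∑ i, ∑ j, Real.exp (y j) * Complex.normSq (Z i j) +
        κ ^ 2 / 6 * ∑ i, ∑ j, Real.exp (x i) * Complex.normSq (Z i j) := by
      rw [← r7, ← r8]; ring
    rw [r5, r6, h12]
    simp only [Finset.mul_sum, ← Finset.sum_add_distrib, ← Finset.sum_sub_distrib]
    refine Finset.sum_congr rfl fun i _ => Finset.sum_congr rfl fun j _ => ?_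
    rw [map_mul, Complex.normSq_ofReal, mul_assoc (κ : ℂ), Complex.re_ofReal_mul]
    ring
  have hR : ∑ i, ∑ j, Complex.normSq (M i j) *
        (Real.exp (x i) * (x i - y j) - Real.exp (x i) + Real.exp (y j)) =
      (ρ * H).trace.re - (ρ * G).trace.re := by
    have h11 : (ρ * H).trace.re - (ρ * G).trace.re = (ρ * H).trace.re - (ρ * G).trace.re -
        ∑ i, ∑ j, Real.exp (x i) * Complex.normSq (M i j) +
        ∑ i, ∑ j, Real.exp (y j) * Complex.normSq (M i j) := by
      rw [← r3, ← r4]; ring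
    rw [h11, r1, r2]
    simp only [← Finset.sum_add_distrib, ← Finset.sum_sub_distrib]
    refine Finset.sum_congr rfl fun i _ => Finset.sum_congr rfl fun j _ => ?_
    ring
  rw [hL, hR] at hsum
  have hκ' : κ = (S * ρ).trace.re - (S * σ).trace.re := by
    rw [hκ, Matrix.mul_sub, Matrix.trace_sub, Complex.sub_re]
  rw [Matrix.mul_sub, Matrix.trace_sub, Complex.sub_re]
  have : κ * (S * ρ).trace.re - κ * (S * σ).trace.re = κ ^ 2 := by rw [← mul_sub, ← hκ', sq]
  linarith

/-! ### Relative entropy and max-relative entropy. -/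

/-- Let B = σ⁻¹ρ and t = Tr(ρ²σ⁻¹). The traces of B†(Kσ - ρ)B ≥ 0 and (B - K)†ρ(B - K) ≥ 0 add up to
K(K - t) ≥ 0. -/
theorem trace_mul_mul_inv_le {a : Type*} [Fintype a] [DecidableEq a]
    {ρ σ σi : Matrix a a ℂ} (hρ : ρ.PosSemidef) (hρ1 : ρ.trace = 1)
    (hσih : σi.conjTranspose = σi) (hinv : σ * σi = 1) {K : ℝ} (hK : 0 < K)
    (h : ((K : ℂ) • σ - ρ).PosSemidef) : (ρ * ρ * σi).trace.re ≤ K := by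
  have hρh : ρ.conjTranspose = ρ := hρ.isHermitian
  have a1 := (h.conjTranspose_mul_mul_same (σi * ρ)).trace_nonneg
  have a2 := (hρ.conjTranspose_mul_mul_same (σi * ρ - (K : ℂ) • 1)).trace_nonneg
  have b1 : (σi * ρ).conjTranspose * ((K : ℂ) • σ - ρ) * (σi * ρ) =
      (K : ℂ) • (ρ * σi * ρ) - ρ * σi * ρ * σi * ρ := by
    rw [Matrix.conjTranspose_mul, hρh, hσih, Matrix.mul_sub, Matrix.sub_mul, Matrix.mul_smul,
      Matrix.smul_mul]
    congr 1
    · rw [Matrix.mul_assoc (ρ * σi), ← Matrix.mul_assoc σ, hinv, Matrix.one_mul]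
    · simp only [Matrix.mul_assoc]
  have b2 : (σi * ρ - (K : ℂ) • 1).conjTranspose * ρ * (σi * ρ - (K : ℂ) • 1) =
      ρ * σi * ρ * σi * ρ - (K : ℂ) • (ρ * σi * ρ) - (K : ℂ) • (ρ * (σi * ρ)) +
        (K * K : ℂ) • ρ := by
    rw [Matrix.conjTranspose_sub, Matrix.conjTranspose_mul, hρh, hσih,
      Matrix.conjTranspose_smul, Matrix.conjTranspose_one]
    simp only [Matrix.sub_mul, Matrix.mul_sub, Matrix.smul_mul, Matrix.mul_smul, Matrix.one_mul,
      Matrix.mul_one, Matrix.mul_assoc, smul_sub, smul_smul, Complex.star_def, Complex.conj_ofReal]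
    abel
  rw [b1] at a1
  rw [b2] at a2
  have c : (ρ * σi * ρ).trace = (ρ * ρ * σi).trace := Matrix.trace_mul_cycle _ _ _
  have c' : (ρ * (σi * ρ)).trace = (ρ * ρ * σi).trace := by rw [← c, Matrix.mul_assoc]
  simp only [Matrix.trace_sub, Matrix.trace_add, Matrix.trace_smul, hρ1, c, c',
    smul_eq_mul] at a1 a2
  have a3 := add_nonneg a1 a2
  have a4 := (Complex.le_def.1 a3).1
  have : (↑K * (ρ * ρ * σi).trace - (ρ * σi * ρ * σi * ρ).trace +
    ((ρ * σi * ρ * σi * ρ).trace - ↑K * (ρ * ρ * σi).trace - ↑K * (ρ * ρ * σi).trace +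
      ↑K * ↑K * 1)) = (K : ℂ) * ((K : ℂ) - (ρ * ρ * σi).trace) := by ring
  rw [this, Complex.re_ofReal_mul, Complex.sub_re, Complex.ofReal_re, Complex.zero_re] at a4
  have := nonneg_of_mul_nonneg_right a4 hK
  linarith

/-- The relative entropy is at most the max-relative entropy. -/
theorem IsLog.trace_mul_sub_le_log {a : Type*} [Fintype a] [DecidableEq a]
    {ρ σ H G : Matrix a a ℂ} (hρ : IsLog ρ H) (hσ : IsLog σ G) (hρ1 : ρ.trace = 1)
    {K : ℝ} (hK : 0 < K) (h : ((K : ℂ) • σ - ρ).PosSemidef) :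
    (ρ * (H - G)).trace.re ≤ Real.log K := by
  have hρpos := hρ.posDef.posSemidef
  obtain ⟨U, x, hU, hU', rfl, rfl⟩ := hρ
  obtain ⟨V, y, hV, hV', rfl, rfl⟩ := hσ
  set ρ := U * Matrix.diagonal (fun i => ((Real.exp (x i) : ℝ) : ℂ)) * U.conjTranspose with hρ
  set σ := V * Matrix.diagonal (fun i => ((Real.exp (y i) : ℝ) : ℂ)) * V.conjTranspose with hσ
  set H := U * Matrix.diagonal (fun i => ((x i : ℝ) : ℂ)) * U.conjTranspose with hH
  set G := V * Matrix.diagonal (fun i => ((y i : ℝ) : ℂ)) * V.conjTranspose with hG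
  set σi := V * Matrix.diagonal (fun i => ((Real.exp (-y i) : ℝ) : ℂ)) * V.conjTranspose with hσi
  set M := U.conjTranspose * 1 * V with hM
  have mulconj : ∀ (W : Matrix a a ℂ), W.conjTranspose * W = 1 → ∀ f g : a → ℝ,
      (W * Matrix.diagonal (fun i => ((f i : ℝ) : ℂ)) * W.conjTranspose) *
        (W * Matrix.diagonal (fun i => ((g i : ℝ) : ℂ)) * W.conjTranspose) =
      W * Matrix.diagonal (fun i => ((f i * g i : ℝ) : ℂ)) * W.conjTranspose := by
    intro W hW f g
    have : (W * Matrix.diagonal (fun i => ((f i : ℝ) : ℂ)) * W.conjTranspose) *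
        (W * Matrix.diagonal (fun i => ((g i : ℝ) : ℂ)) * W.conjTranspose) =
        W * Matrix.diagonal (fun i => ((f i : ℝ) : ℂ)) * (W.conjTranspose * W) *
          Matrix.diagonal (fun i => ((g i : ℝ) : ℂ)) * W.conjTranspose := by
      simp only [Matrix.mul_assoc]
    rw [this, hW, Matrix.mul_one, Matrix.mul_assoc W, Matrix.diagonal_mul_diagonal]
    simp only [Complex.ofReal_mul]
  have one_V : V * Matrix.diagonal (fun _ => (1 : ℂ)) * V.conjTranspose = 1 := by
    rw [Matrix.diagonal_one, Matrix.mul_one, hV']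
  have hinv : σ * σi = 1 := by
    rw [hσ, hσi, mulconj V hV]
    simp only [← Real.exp_add, add_neg_cancel, Real.exp_zero, Complex.ofReal_one]
    exact one_V
  have herm : ∀ (W : Matrix a a ℂ) (f : a → ℝ),
      (W * Matrix.diagonal (fun i => ((f i : ℝ) : ℂ)) * W.conjTranspose).conjTranspose =
      W * Matrix.diagonal (fun i => ((f i : ℝ) : ℂ)) * W.conjTranspose := by
    intro W f
    simp only [Matrix.conjTranspose_mul, Matrix.conjTranspose_conjTranspose,
      Matrix.diagonal_conjTranspose, Matrix.mul_assoc]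
    congr 3
    ext i
    simp
  have e1 : (ρ * H).trace = ∑ i, ∑ j, ((Real.exp (x i) * x i : ℝ) : ℂ) * 1 * M i j *
      star (M i j) := by
    rw [hM, ← trace_mul_diagonal_sandwich, one_V, hρ, hH, mulconj U hU]
    simp
  have e2 : (ρ * G).trace = ∑ i, ∑ j, ((Real.exp (x i) : ℝ) : ℂ) * ((y j : ℝ) : ℂ) * M i j *
      star (M i j) := by
    rw [hM, ← trace_mul_diagonal_sandwich]
    simp [hρ, hG]
  have e3 : (1 : ℂ) = ∑ i, ∑ j, ((Real.exp (x i) : ℝ) : ℂ) * 1 * M i j * star (M i j) := by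
    rw [hM, ← trace_mul_diagonal_sandwich, one_V, ← hρ1]
    simp [hρ]
  have e4 : (ρ * ρ * σi).trace = ∑ i, ∑ j, ((Real.exp (x i) * Real.exp (x i) : ℝ) : ℂ) *
      ((Real.exp (-y j) : ℝ) : ℂ) * M i j * star (M i j) := by
    rw [hM, ← trace_mul_diagonal_sandwich, hρ, mulconj U hU]
    simp [hσi]
  have ht : (ρ * ρ * σi).trace.re ≤ K :=
    trace_mul_mul_inv_le hρpos hρ1 (herm V _) hinv hK h
  have ns : ∀ w : ℂ, (Complex.normSq w : ℂ) = w * star w := fun w =>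
    Complex.normSq_eq_conj_mul_self.trans (mul_comm _ _)
  have r1 := congrArg Complex.re e1
  have r2 := congrArg Complex.re e2
  have r3 := congrArg Complex.re e3
  have r4 := congrArg Complex.re e4
  simp only [mul_one, mul_assoc, Complex.re_sum, ← ns, Complex.re_ofReal_mul,
    Complex.ofReal_re, Complex.one_re] at r1 r2 r3 r4
  rw [Matrix.mul_sub, Matrix.trace_sub, Complex.sub_re, r1, r2]
  -- The bound ln s ≤ s - 1 at s = exp(x i - y j)/K. Its sum involves only Tr(ρ²σ⁻¹), so operator
  -- monotonicity of the logarithm is not needed.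
  have hterm : ∀ i j, Real.exp (x i) * (x i * Complex.normSq (M i j)) -
      Real.exp (x i) * (y j * Complex.normSq (M i j)) ≤
      (Real.log K - 1) * (Real.exp (x i) * Complex.normSq (M i j)) +
      K⁻¹ * (Real.exp (x i) * (Real.exp (x i) * (Real.exp (-y j) * Complex.normSq (M i j)))) := by
    intro i j
    have h1 : x i - y j - Real.log K ≤ K⁻¹ * (Real.exp (x i) * Real.exp (-y j)) - 1 := by
      have := Real.add_one_le_exp (x i - y j - Real.log K)
      have h2 : Real.exp (x i - y j - Real.log K) = K⁻¹ * (Real.exp (x i) * Real.exp (-y j)) := by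
        rw [Real.exp_sub, Real.exp_log hK, sub_eq_add_neg, Real.exp_add]
        field_simp
      linarith
    have h3 := mul_le_mul_of_nonneg_left h1
      (mul_nonneg (Real.exp_pos (x i)).le (Complex.normSq_nonneg (M i j)))
    linarith
  calc _ ≤ ∑ i, ∑ j, ((Real.log K - 1) * (Real.exp (x i) * Complex.normSq (M i j)) +
      K⁻¹ * (Real.exp (x i) * (Real.exp (x i) *
        (Real.exp (-y j) * Complex.normSq (M i j))))) := by
        simp only [← Finset.sum_sub_distrib]
        exact Finset.sum_le_sum fun i _ => Finset.sum_le_sum fun j _ => hterm i j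
    _ = (Real.log K - 1) * ∑ i, ∑ j, Real.exp (x i) * Complex.normSq (M i j) +
        K⁻¹ * (ρ * ρ * σi).trace.re := by
        rw [Matrix.mul_assoc ρ ρ σi, r4]
        simp only [Finset.mul_sum, ← Finset.sum_add_distrib]
    _ ≤ (Real.log K - 1) * 1 + K⁻¹ * K := by rw [← r3]; gcongr
    _ = Real.log K := by rw [inv_mul_cancel₀ hK.ne']; ring

/-! ### Adding and discarding the last site -/

/-- The tensor product of an operator on `n` sites and an operator on a further site. -/
def appendSite {a : Type*} {n : ℕ} (A : Matrix (Fin n → a) (Fin n → a) ℂ) (B : Matrix a a ℂ) :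
    Matrix (Fin (n + 1) → a) (Fin (n + 1) → a) ℂ :=
  Matrix.of fun x y => A (Fin.init x) (Fin.init y) * B (x (Fin.last n)) (y (Fin.last n))

/-- The partial trace over the last of `n + 1` sites. -/
def traceLast {a : Type*} [Fintype a] {n : ℕ}
    (A : Matrix (Fin (n + 1) → a) (Fin (n + 1) → a) ℂ) : Matrix (Fin n → a) (Fin n → a) ℂ :=
  Matrix.of fun x y => ∑ s, A (Fin.snoc x s) (Fin.snoc y s)

theorem sum_snoc {a : Type*} [Fintype a] {n : ℕ} {M : Type*} [AddCommMonoid M]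
    (f : (Fin (n + 1) → a) → M) : ∑ x, f x = ∑ x : Fin n → a, ∑ s, f (Fin.snoc x s) := by
  rw [← (Fin.snocEquiv fun _ => a).sum_comp, Fintype.sum_prod_type_right]
  rfl

theorem init_eq_and_last_eq_iff {a : Type*} {n : ℕ} (x y : Fin (n + 1) → a) :
    (Fin.init x = Fin.init y ∧ x (Fin.last n) = y (Fin.last n)) ↔ x = y := by
  refine ⟨fun ⟨h1, h2⟩ => ?_, fun h => by rw [h]; exact ⟨rfl, rfl⟩⟩
  rw [← Fin.snoc_init_self x, ← Fin.snoc_init_self y, h1, h2]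

theorem appendSite_snoc {a : Type*} {n : ℕ} (A : Matrix (Fin n → a) (Fin n → a) ℂ)
    (B : Matrix a a ℂ) (x y : Fin n → a) (s t : a) :
    appendSite A B (Fin.snoc x s) (Fin.snoc y t) = A x y * B s t := by
  simp [appendSite]

theorem tensorPower_succ {a : Type*} (n : ℕ) (ρ : Matrix a a ℂ) :
    tensorPower (n + 1) ρ = appendSite (tensorPower n ρ) ρ := by
  ext x y
  simp only [tensorPower, appendSite, Matrix.of_apply, Fin.prod_univ_castSucc]
  rfl

theorem appendSite_eq_kronecker {a : Type*} {n : ℕ} (A : Matrix (Fin n → a) (Fin n → a) ℂ)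
    (B : Matrix a a ℂ) : appendSite A B = (Matrix.kronecker B A).submatrix
      (Fin.snocEquiv fun _ => a).symm (Fin.snocEquiv fun _ => a).symm := by
  ext x y
  simp only [appendSite, Matrix.of_apply, Matrix.kronecker, Matrix.submatrix_apply,
    Matrix.kroneckerMap_apply]
  exact mul_comm _ _

section

variable {a : Type*} {n : ℕ}

theorem appendSite_conjTranspose (A : Matrix (Fin n → a) (Fin n → a) ℂ) (B : Matrix a a ℂ) :
    (appendSite A B).conjTranspose = appendSite A.conjTranspose B.conjTranspose := by
  ext x y
  simp [appendSite]

theorem appendSite_diagonal [DecidableEq a] (f : (Fin n → a) → ℂ) (g : a → ℂ) :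
    appendSite (Matrix.diagonal f) (Matrix.diagonal g) =
      Matrix.diagonal fun x => f (Fin.init x) * g (x (Fin.last n)) := by
  ext x y
  simp only [appendSite, Matrix.of_apply, Matrix.diagonal_apply, ← init_eq_and_last_eq_iff x y]
  split_ifs <;> simp_all

theorem appendSite_one [DecidableEq a] :
    appendSite (1 : Matrix (Fin n → a) (Fin n → a) ℂ) (1 : Matrix a a ℂ) = 1 := by
  rw [← Matrix.diagonal_one, ← Matrix.diagonal_one, appendSite_diagonal]
  simp

theorem appendSite_sub_left (A C : Matrix (Fin n → a) (Fin n → a) ℂ) (B : Matrix a a ℂ) :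
    appendSite (A - C) B = appendSite A B - appendSite C B := by
  ext x y
  simp [appendSite, sub_mul]

theorem appendSite_sub_right (A : Matrix (Fin n → a) (Fin n → a) ℂ) (B C : Matrix a a ℂ) :
    appendSite A (B - C) = appendSite A B - appendSite A C := by
  ext x y
  simp [appendSite, mul_sub]

theorem appendSite_smul_left (c : ℂ) (A : Matrix (Fin n → a) (Fin n → a) ℂ) (B : Matrix a a ℂ) :
    appendSite (c • A) B = c • appendSite A B := by
  ext x y
  simp [appendSite, mul_assoc]

theorem appendSite_smul_right (c : ℂ) (A : Matrix (Fin n → a) (Fin n → a) ℂ) (B : Matrix a a ℂ) :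
    appendSite A (c • B) = c • appendSite A B := by
  ext x y
  simp [appendSite, mul_left_comm]

theorem appendSite_sum_left {ι : Type*} (s : Finset ι)
    (A : ι → Matrix (Fin n → a) (Fin n → a) ℂ) (B : Matrix a a ℂ) :
    appendSite (∑ i ∈ s, A i) B = ∑ i ∈ s, appendSite (A i) B := by
  ext x y
  simp [appendSite, Matrix.sum_apply, Finset.sum_mul]

variable [Fintype a]

theorem appendSite_mul (A C : Matrix (Fin n → a) (Fin n → a) ℂ) (B D : Matrix a a ℂ) :
    appendSite A B * appendSite C D = appendSite (A * C) (B * D) := by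
  rw [appendSite_eq_kronecker, appendSite_eq_kronecker, appendSite_eq_kronecker,
    Matrix.submatrix_mul_equiv]
  exact congrArg (fun M => Matrix.submatrix M _ _) (Matrix.mul_kronecker_mul B D A C).symm

theorem trace_appendSite (A : Matrix (Fin n → a) (Fin n → a) ℂ) (B : Matrix a a ℂ) :
    (appendSite A B).trace = A.trace * B.trace := by
  simp only [Matrix.trace, Matrix.diag_apply, sum_snoc, appendSite_snoc, Finset.sum_mul_sum]

theorem Matrix.PosSemidef.appendSite {A : Matrix (Fin n → a) (Fin n → a) ℂ} {B : Matrix a a ℂ}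
    (hA : A.PosSemidef) (hB : B.PosSemidef) : (appendSite A B).PosSemidef := by
  rw [appendSite_eq_kronecker]
  exact (hB.kronecker hA).submatrix _

theorem IsState.appendSite {A : Matrix (Fin n → a) (Fin n → a) ℂ} {B : Matrix a a ℂ}
    (hA : IsState A) (hB : IsState B) : IsState (appendSite A B) :=
  ⟨hA.1.appendSite hB.1, by rw [trace_appendSite, hA.2, hB.2, one_mul]⟩

theorem IsState.tensorPower {ρ : Matrix a a ℂ} (hρ : IsState ρ) (n : ℕ) :
    IsState (tensorPower n ρ) := by
  induction n with
  | zero =>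
    have h1 : _root_.tensorPower 0 ρ = Matrix.of fun _ _ => 1 := by
      ext x y
      simp [_root_.tensorPower]
    classical
    have h2 : (Matrix.of fun _ _ => 1 : Matrix (Fin 0 → a) (Fin 0 → a) ℂ) = 1 := by
      ext x y
      rw [Subsingleton.elim x y, Matrix.one_apply_eq, Matrix.of_apply]
    rw [h1, h2]
    exact ⟨Matrix.PosSemidef.one, by simp⟩
  | succ n ih =>
    rw [tensorPower_succ]
    exact ih.appendSite hρ

/-- Logarithms of tensor products are additive; this makes the chain rule for relative entropy an
exact cancellation. -/
theorem IsLog.appendSite [DecidableEq a] {A H : Matrix (Fin n → a) (Fin n → a) ℂ}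
    {B G : Matrix a a ℂ} (hA : IsLog A H) (hB : IsLog B G) :
    IsLog (appendSite A B) (appendSite H 1 + appendSite 1 G) := by
  obtain ⟨U, d, hU, hU', rfl, rfl⟩ := hA
  obtain ⟨V, e, hV, hV', rfl, rfl⟩ := hB
  refine ⟨_root_.appendSite U V, fun x => d (Fin.init x) + e (x (Fin.last n)), ?_, ?_, ?_, ?_⟩
  · rw [appendSite_conjTranspose, appendSite_mul, hU, hV, appendSite_one]
  · rw [appendSite_conjTranspose, appendSite_mul, hU', hV', appendSite_one]
  · rw [← appendSite_mul, ← appendSite_mul, appendSite_diagonal, appendSite_conjTranspose]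
    simp only [Real.exp_add, Complex.ofReal_mul]
  · have hV1 : (1 : Matrix a a ℂ) = V * Matrix.diagonal (fun _ => 1) * V.conjTranspose := by
      rw [Matrix.diagonal_one, Matrix.mul_one, hV']
    have hU1 : (1 : Matrix (Fin n → a) (Fin n → a) ℂ) =
        U * Matrix.diagonal (fun _ => 1) * U.conjTranspose := by
      rw [Matrix.diagonal_one, Matrix.mul_one, hU']
    rw [hV1, hU1, ← appendSite_mul, ← appendSite_mul, ← appendSite_mul, ← appendSite_mul,
      appendSite_diagonal, appendSite_diagonal, ← appendSite_conjTranspose, ← Matrix.add_mul,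
      ← Matrix.mul_add, Matrix.diagonal_add]
    simp only [mul_one, one_mul, Complex.ofReal_add]

theorem trace_traceLast (A : Matrix (Fin (n + 1) → a) (Fin (n + 1) → a) ℂ) :
    (traceLast A).trace = A.trace := by
  simp only [Matrix.trace, Matrix.diag_apply, sum_snoc, traceLast, Matrix.of_apply]

theorem traceLast_eq_sum (A : Matrix (Fin (n + 1) → a) (Fin (n + 1) → a) ℂ) :
    traceLast A = ∑ s, A.submatrix (fun x => Fin.snoc x s) (fun x => Fin.snoc x s) := by
  ext x y
  simp [traceLast, Matrix.sum_apply]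

theorem IsState.traceLast {A : Matrix (Fin (n + 1) → a) (Fin (n + 1) → a) ℂ} (hA : IsState A) :
    IsState (traceLast A) := by
  refine ⟨?_, by rw [trace_traceLast, hA.2]⟩
  rw [traceLast_eq_sum]
  exact Matrix.posSemidef_sum _ fun s _ => hA.1.submatrix _

theorem Matrix.PosDef.traceLast [Nonempty a] {A : Matrix (Fin (n + 1) → a) (Fin (n + 1) → a) ℂ}
    (hA : A.PosDef) : (traceLast A).PosDef := by
  rw [traceLast_eq_sum]
  refine Matrix.posDef_sum Finset.univ_nonempty fun s _ => hA.submatrix fun x y h => ?_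
  simpa using congrArg Fin.init h

theorem traceLast_appendSite (A : Matrix (Fin n → a) (Fin n → a) ℂ) (B : Matrix a a ℂ) :
    traceLast (appendSite A B) = B.trace • A := by
  ext x y
  simp only [traceLast, Matrix.of_apply, appendSite_snoc, ← Finset.mul_sum, Matrix.smul_apply,
    smul_eq_mul, Matrix.trace, Matrix.diag_apply]
  exact mul_comm _ _

theorem trace_mul_appendSite_one [DecidableEq a] (A : Matrix (Fin (n + 1) → a) (Fin (n + 1) → a) ℂ)
    (B : Matrix (Fin n → a) (Fin n → a) ℂ) :
    (A * appendSite B 1).trace = (traceLast A * B).trace := by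
  simp only [Matrix.trace, Matrix.diag_apply, Matrix.mul_apply, sum_snoc, appendSite_snoc,
    traceLast, Matrix.of_apply, Finset.sum_mul]
  refine Finset.sum_congr rfl fun x _ => ?_
  rw [Finset.sum_comm]
  refine Finset.sum_congr rfl fun y _ => Finset.sum_congr rfl fun s _ => ?_
  simp [Matrix.one_apply]

/-! ### Decompositions into differences of states that differ at a single site -/

/-- Removes the subtype index of the remaining sites, so that the condition can be checked by
updating full configurations. -/
theorem traceSite_eq_iff (i : Fin n) (A B : Matrix (Fin n → a) (Fin n → a) ℂ) :
    traceSite i A = traceSite i B ↔ ∀ x y : Fin n → a,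
      ∑ s, A (Function.update x i s) (Function.update y i s) =
        ∑ s, B (Function.update x i s) (Function.update y i s) := by
  have key : ∀ (s : a) (x : Fin n → a),
      (Equiv.funSplitAt i a).symm (s, fun j => x j) = Function.update x i s := by
    intro s x
    ext j
    by_cases hj : j = i
    · subst hj; simp [Equiv.funSplitAt, Equiv.piSplitAt]
    · simp [Equiv.funSplitAt, Equiv.piSplitAt, hj]
  constructor
  · intro h x y
    have := congrFun (congrFun h fun j => x j) fun j => y j
    simpa only [traceSite, Matrix.of_apply, key] using this
  · intro h
    ext x y
    rcases isEmpty_or_nonempty a with ha | ⟨⟨s₀⟩⟩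
    · simp [traceSite]
    · have hx : ∀ z : {j : Fin n // j ≠ i} → a,
          z = fun j : {j : Fin n // j ≠ i} => (Equiv.funSplitAt i a).symm (s₀, z) j := by
        intro z
        ext j
        simp [Equiv.funSplitAt, Equiv.piSplitAt, j.2]
      rw [hx x, hx y]
      simpa only [traceSite, Matrix.of_apply, key] using h _ _

theorem traceSite_last_eq {A B : Matrix (Fin (n + 1) → a) (Fin (n + 1) → a) ℂ}
    (h : traceLast A = traceLast B) : traceSite (Fin.last n) A = traceSite (Fin.last n) B := by
  rw [traceSite_eq_iff]
  intro x y
  have := congrFun (congrFun h (Fin.init x)) (Fin.init y)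
  have hu : ∀ (x : Fin (n + 1) → a) (s : a),
      Function.update x (Fin.last n) s = Fin.snoc (Fin.init x) s := by
    intro x s
    conv_lhs => rw [← Fin.snoc_init_self x, Fin.update_snoc_last]
  simpa only [hu, traceLast, Matrix.of_apply] using this

theorem traceSite_castSucc_appendSite {i : Fin n} {A B : Matrix (Fin n → a) (Fin n → a) ℂ}
    (h : traceSite i A = traceSite i B) (C : Matrix a a ℂ) :
    traceSite i.castSucc (appendSite A C) = traceSite i.castSucc (appendSite B C) := by
  rw [traceSite_eq_iff] at h ⊢
  intro x y
  have hl : ∀ (x : Fin (n + 1) → a) (s : a),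
      Function.update x i.castSucc s (Fin.last n) = x (Fin.last n) := fun x s =>
    Function.update_of_ne (Fin.castSucc_lt_last i).ne' _ _
  simp only [appendSite, Matrix.of_apply, Fin.init_update_castSucc, hl, ← Finset.sum_mul, h]

/-- `A - B = ∑ c_i (τ_i - η_i)` with states `τ_i`, `η_i` that agree after tracing out site `i`. -/
def HasSiteCosts (c : Fin n → ℝ) (A B : Matrix (Fin n → a) (Fin n → a) ℂ) : Prop :=
  ∃ τ η : Fin n → Matrix (Fin n → a) (Fin n → a) ℂ,
    (∀ i, 0 ≤ c i) ∧ (∀ i, IsState (τ i)) ∧ (∀ i, IsState (η i)) ∧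
    (∀ i, traceSite i (τ i) = traceSite i (η i)) ∧ A - B = ∑ i, (c i : ℂ) • (τ i - η i)

theorem HasSiteCosts.wassersteinDist_le {c : Fin n → ℝ} {A B : Matrix (Fin n → a) (Fin n → a) ℂ}
    (h : HasSiteCosts c A B) : wassersteinDist A B ≤ ∑ i, c i := by
  obtain ⟨τ, η, h0, h1, h2, h3, h4⟩ := h
  refine csInf_le ⟨0, ?_⟩ ⟨c, τ, η, h0, h1, h2, h3, h4, rfl⟩
  rintro w ⟨c, τ, η, h0, -, -, -, -, rfl⟩
  exact Finset.sum_nonneg fun i _ => h0 i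

theorem wassersteinDist_nonneg (A B : Matrix (Fin n → a) (Fin n → a) ℂ) :
    0 ≤ wassersteinDist A B := by
  refine Real.sInf_nonneg ?_
  rintro w ⟨c, τ, η, h0, -, -, -, -, rfl⟩
  exact Finset.sum_nonneg fun i _ => h0 i

/-- Tensoring the old terms with `σ` preserves their agreement off their own sites; the new term is
charged to the last site. -/
theorem HasSiteCosts.snoc {c : Fin n → ℝ} {A B : Matrix (Fin n → a) (Fin n → a) ℂ}
    (h : HasSiteCosts c A B) {σ : Matrix a a ℂ} (hσ : IsState σ) {e : ℝ} (he : 0 ≤ e)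
    {τ η C D : Matrix (Fin (n + 1) → a) (Fin (n + 1) → a) ℂ} (hτ : IsState τ) (hη : IsState η)
    (hτη : traceLast τ = traceLast η) (hCD : C - D = appendSite (A - B) σ + (e : ℂ) • (τ - η)) :
    HasSiteCosts (Fin.snoc c e : Fin (n + 1) → ℝ) C D := by
  obtain ⟨τ', η', h0, h1, h2, h3, h4⟩ := h
  refine ⟨Fin.snoc (fun i => appendSite (τ' i) σ) τ, Fin.snoc (fun i => appendSite (η' i) σ) η,
    ?_, ?_, ?_, ?_, ?_⟩
  · intro i
    induction i using Fin.lastCases with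
    | last => simpa using he
    | cast i => simpa using h0 i
  · intro i
    induction i using Fin.lastCases with
    | last => simpa using hτ
    | cast i => simpa using (h1 i).appendSite hσ
  · intro i
    induction i using Fin.lastCases with
    | last => simpa using hη
    | cast i => simpa using (h2 i).appendSite hσ
  · intro i
    induction i using Fin.lastCases with
    | last => simpa using traceSite_last_eq hτη
    | cast i => simpa using traceSite_castSucc_appendSite (h3 i) σ
  · rw [hCD, h4, Fin.sum_univ_castSucc, appendSite_sum_left]
    simp only [appendSite_smul_left, appendSite_sub_left, Fin.snoc_castSucc, Fin.snoc_last]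

theorem traceSite_add (i : Fin n) (A B : Matrix (Fin n → a) (Fin n → a) ℂ) :
    traceSite i (A + B) = traceSite i A + traceSite i B := by
  ext x y
  simp [traceSite, Finset.sum_add_distrib]

theorem traceSite_smul (i : Fin n) (c : ℂ) (A : Matrix (Fin n → a) (Fin n → a) ℂ) :
    traceSite i (c • A) = c • traceSite i A := by
  ext x y
  simp [traceSite, Finset.mul_sum]

theorem IsState.convex_combination {b : Type*} [Fintype b] {A B : Matrix b b ℂ} (hA : IsState A)
    (hB : IsState B) {s t : ℝ} (hs : 0 ≤ s) (ht : 0 ≤ t) (hst : s + t = 1) :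
    IsState ((s : ℂ) • A + (t : ℂ) • B) := by
  refine ⟨(hA.1.smul (by exact_mod_cast hs)).add (hB.1.smul (by exact_mod_cast ht)), ?_⟩
  rw [Matrix.trace_add, Matrix.trace_smul, Matrix.trace_smul, hA.2, hB.2]
  simp only [smul_eq_mul, mul_one]
  exact_mod_cast hst

/-- The two terms at a site merge into one by convex combination with weights proportional to their
costs, which keeps the marginal condition. -/
theorem HasSiteCosts.trans {c e : Fin n → ℝ} {A B C : Matrix (Fin n → a) (Fin n → a) ℂ}
    (h : HasSiteCosts c A B) (h' : HasSiteCosts e B C) :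
    HasSiteCosts (fun i => c i + e i) A C := by
  obtain ⟨τ, η, h0, h1, h2, h3, h4⟩ := h
  obtain ⟨τ', η', h0', h1', h2', h3', h4'⟩ := h'
  have hw : ∀ i, ∃ s t : ℝ, 0 ≤ s ∧ 0 ≤ t ∧ s + t = 1 ∧ (c i + e i) * s = c i ∧
      (c i + e i) * t = e i := by
    intro i
    rcases (add_nonneg (h0 i) (h0' i)).eq_or_lt with h | h
    · have h5 := h0 i
      have h6 := h0' i
      exact ⟨1, 0, by norm_num, le_rfl, by norm_num, by linarith, by linarith⟩
    · exact ⟨c i / (c i + e i), e i / (c i + e i), div_nonneg (h0 i) h.le,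
        div_nonneg (h0' i) h.le, by rw [← add_div, div_self h.ne'], mul_div_cancel₀ _ h.ne',
        mul_div_cancel₀ _ h.ne'⟩
  choose s t hs ht hst hcs het using hw
  refine ⟨fun i => (s i : ℂ) • τ i + (t i : ℂ) • τ' i, fun i => (s i : ℂ) • η i + (t i : ℂ) • η' i,
    fun i => add_nonneg (h0 i) (h0' i),
    fun i => (h1 i).convex_combination (h1' i) (hs i) (ht i) (hst i),
    fun i => (h2 i).convex_combination (h2' i) (hs i) (ht i) (hst i), fun i => ?_, ?_⟩
  · simp only [traceSite_add, traceSite_smul, h3, h3']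
  · rw [← sub_add_sub_cancel A B C, h4, h4', ← Finset.sum_add_distrib]
    refine Finset.sum_congr rfl fun i _ => ?_
    have hc : (c i : ℂ) = (c i + e i) * s i := by exact_mod_cast (hcs i).symm
    have he : (e i : ℂ) = (c i + e i) * t i := by exact_mod_cast (het i).symm
    have hr : ((c i + e i : ℝ) : ℂ) • ((s i : ℂ) • τ i + (t i : ℂ) • τ' i -
        ((s i : ℂ) • η i + (t i : ℂ) • η' i)) =
        ((c i + e i) * s i : ℂ) • (τ i - η i) + ((c i + e i) * t i : ℂ) • (τ' i - η' i) := by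
      push_cast
      module
    rw [hr, ← hc, ← he]

theorem HasSiteCosts.smul {c : Fin n → ℝ} {A B C : Matrix (Fin n → a) (Fin n → a) ℂ}
    (h : HasSiteCosts c A B) {k : ℝ} (hk : 0 ≤ k) (hC : C - B = (k : ℂ) • (A - B)) :
    HasSiteCosts (fun i => k * c i) C B := by
  obtain ⟨τ, η, h0, h1, h2, h3, h4⟩ := h
  refine ⟨τ, η, fun i => mul_nonneg hk (h0 i), h1, h2, h3, ?_⟩
  rw [hC, h4, Finset.smul_sum]
  simp only [smul_smul, Complex.ofReal_mul]

theorem HasSiteCosts.refl {A B : Matrix (Fin n → a) (Fin n → a) ℂ} (hA : IsState A) (h : A = B) :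
    HasSiteCosts (fun _ => 0) A B :=
  ⟨fun _ => A, fun _ => A, fun _ => le_rfl, fun _ => hA, fun _ => hA, fun _ => rfl, by simp [h]⟩

theorem IsState.eq_of_subsingleton {b : Type*} [Fintype b] [Subsingleton b] {A B : Matrix b b ℂ}
    (hA : IsState A) (hB : IsState B) : A = B := by
  ext x y
  have h1 := hA.2
  have h2 := hB.2
  simp only [Matrix.trace, Matrix.diag_apply] at h1 h2
  rw [Fintype.sum_subsingleton _ x] at h1 h2
  rw [Subsingleton.elim y x, h1, h2]

/-- Telescoping: A - ρ^{⊗(n+1)} = (A' - ρ^{⊗n}) ⊗ ρ + (A - A' ⊗ ρ), with A' the marginal of A; the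
last bracket is a difference of states with equal marginals, at cost 1. -/
theorem IsState.hasSiteCosts_one {ρ : Matrix a a ℂ} (hρ : IsState ρ)
    {A : Matrix (Fin n → a) (Fin n → a) ℂ} (hA : IsState A) :
    HasSiteCosts (fun _ => 1) A (_root_.tensorPower n ρ) := by
  induction n with
  | zero => exact ⟨fun _ => A, fun _ => A, fun _ => zero_le_one, fun _ => hA, fun _ => hA,
      fun _ => rfl, by simp [hA.eq_of_subsingleton (hρ.tensorPower 0)]⟩
  | succ n ih =>
    have h := (ih hA.traceLast).snoc hρ zero_le_one hA (hA.traceLast.appendSite hρ)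
      (D := _root_.tensorPower (n + 1) ρ) (C := A)
      (by rw [traceLast_appendSite, hρ.2, one_smul])
      (by rw [appendSite_sub_left, tensorPower_succ]; simp)
    convert h using 1
    ext i
    induction i using Fin.lastCases <;> simp

/-- Telescoping: σ^{⊗(n+1)} - ρ^{⊗(n+1)} = (σ^{⊗n} - ρ^{⊗n}) ⊗ σ + x ρ^{⊗n} ⊗ (τ - ρ). -/
theorem IsState.hasSiteCosts_tensorPower {ρ σ τ : Matrix a a ℂ} (hρ : IsState ρ) (hσ : IsState σ)
    (hτ : IsState τ) {x : ℝ} (hx : 0 ≤ x) (h : σ - ρ = (x : ℂ) • (τ - ρ)) (n : ℕ) :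
    HasSiteCosts (fun _ => x) (_root_.tensorPower n σ) (_root_.tensorPower n ρ) := by
  induction n with
  | zero =>
    have h0 := hσ.tensorPower 0
    exact ⟨fun _ => _root_.tensorPower 0 σ, fun _ => _root_.tensorPower 0 σ, fun _ => hx,
      fun _ => h0, fun _ => h0, fun _ => rfl, by simp [h0.eq_of_subsingleton (hρ.tensorPower 0)]⟩
  | succ n ih =>
    have h := ih.snoc hσ hx ((hρ.tensorPower n).appendSite hτ)
      ((hρ.tensorPower n).appendSite hρ)
      (D := _root_.tensorPower (n + 1) ρ) (C := _root_.tensorPower (n + 1) σ)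
      (by rw [traceLast_appendSite, traceLast_appendSite, hρ.2, hτ.2])
      (by rw [← appendSite_sub_right, ← appendSite_smul_right, ← h, appendSite_sub_left,
            appendSite_sub_right, tensorPower_succ, tensorPower_succ]; abel)
    convert h using 1
    ext i
    induction i using Fin.lastCases <;> simp

end

/-! ### Jordan decomposition and Marton's inequality. -/

/-- Normalised positive and negative parts of `X`; `c` is half the trace norm and `S` the sign of
`X`. For c = 0 the parts cannot be normalised, and both states default to `ρ₀`. -/
theorem Matrix.IsHermitian.exists_jordan_decomposition {b : Type*} [Fintype b] [DecidableEq b]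
    {X : Matrix b b ℂ} (hX : X.IsHermitian) (hX0 : X.trace = 0) {ρ₀ : Matrix b b ℂ}
    (hρ₀ : IsState ρ₀) :
    ∃ (c : ℝ) (τ η S : Matrix b b ℂ), 0 ≤ c ∧ IsState τ ∧ IsState η ∧ X = (c : ℂ) • (τ - η) ∧
      (c = 0 → τ = η) ∧ S.IsHermitian ∧ S * S = 1 ∧ (S * X).trace.re = 2 * c := by
  obtain ⟨U, hU, hU', hXU⟩ := hX.exists_diagonalization
  set d := hX.eigenvalues
  let D : (b → ℝ) → Matrix b b ℂ := fun f =>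
    U * Matrix.diagonal (fun i => (f i : ℂ)) * U.conjTranspose
  have D_psd : ∀ f : b → ℝ, (∀ i, 0 ≤ f i) → (D f).PosSemidef := by
    intro f hf
    refine Matrix.PosSemidef.mul_mul_conjTranspose_same (Matrix.posSemidef_diagonal_iff.2 ?_) _
    intro i
    exact_mod_cast hf i
  have D_trace : ∀ f : b → ℝ, (D f).trace = ((∑ i, f i : ℝ) : ℂ) := by
    intro f
    simp only [D]
    rw [Matrix.trace_mul_comm, ← Matrix.mul_assoc, hU, Matrix.one_mul, Matrix.trace_diagonal]
    push_cast
    rfl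
  have D_sub : ∀ f g : b → ℝ, D f - D g = D (f - g) := by
    intro f g
    simp only [D]
    rw [← Matrix.sub_mul, ← Matrix.mul_sub, Matrix.diagonal_sub]
    simp
  have D_mul : ∀ f g : b → ℝ, D f * D g = D (f * g) := by
    intro f g
    simp only [D]
    have : U * Matrix.diagonal (fun i => (f i : ℂ)) * U.conjTranspose *
        (U * Matrix.diagonal (fun i => (g i : ℂ)) * U.conjTranspose) =
        U * Matrix.diagonal (fun i => (f i : ℂ)) * (U.conjTranspose * U) *
          Matrix.diagonal (fun i => (g i : ℂ)) * U.conjTranspose := by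
      simp only [Matrix.mul_assoc]
    rw [this, hU, Matrix.mul_one, Matrix.mul_assoc U, Matrix.diagonal_mul_diagonal]
    simp
  have D_smul : ∀ (k : ℝ) (f : b → ℝ), D (k • f) = (k : ℂ) • D f := by
    intro k f
    simp only [D]
    rw [← Matrix.smul_mul, ← Matrix.mul_smul, ← Matrix.diagonal_smul]
    congr 3
    ext i
    simp
  have D_herm : ∀ f : b → ℝ, (D f).IsHermitian := by
    intro f
    simp only [D, Matrix.IsHermitian, Matrix.conjTranspose_mul,
      Matrix.conjTranspose_conjTranspose, Matrix.diagonal_conjTranspose, Matrix.mul_assoc]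
    congr 3
    ext i
    simp
  have hXD : X = D d := hXU
  set p : b → ℝ := fun i => max (d i) 0
  set m : b → ℝ := fun i => max (-d i) 0
  have hpm : p - m = d := by
    ext i
    simp only [p, m, Pi.sub_apply]
    rcases le_total (d i) 0 with h | h
    · rw [max_eq_right h, max_eq_left (by linarith)]; ring
    · rw [max_eq_left h, max_eq_right (by linarith)]; ring
  have hsum : ∑ i, p i = ∑ i, m i := by
    have h1 : ∑ i, d i = 0 := by
      rw [hXD, D_trace] at hX0
      exact_mod_cast hX0
    rw [← hpm] at h1
    simp only [Pi.sub_apply, Finset.sum_sub_distrib] at h1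
    linarith
  set c := ∑ i, p i with hc
  have hp0 : ∀ i, 0 ≤ p i := fun i => le_max_right _ _
  have hm0 : ∀ i, 0 ≤ m i := fun i => le_max_right _ _
  have hc0 : 0 ≤ c := Finset.sum_nonneg fun i _ => hp0 i
  -- Zero eigenvalues get sign +1, so that the sign operator squares to the identity.
  set s : b → ℝ := fun i => if 0 ≤ d i then 1 else -1
  have hS2 : D s * D s = 1 := by
    have h1 : s * s = fun _ => 1 := by
      ext i
      simp only [s, Pi.mul_apply]
      split_ifs <;> norm_num
    rw [D_mul, h1]
    simp only [D, Complex.ofReal_one, Matrix.diagonal_one, Matrix.mul_one, hU']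
  have hSX : (D s * X).trace.re = 2 * c := by
    have h1 : s * d = p + m := by
      ext i
      simp only [s, p, m, Pi.mul_apply, Pi.add_apply]
      split_ifs with h
      · rw [max_eq_left h, max_eq_right (by linarith)]; ring
      · rw [max_eq_right (by linarith), max_eq_left (by linarith)]; ring
    rw [hXD, D_mul, D_trace, h1, Complex.ofReal_re]
    simp only [Pi.add_apply, Finset.sum_add_distrib]
    rw [← hsum]
    ring
  rcases hc0.eq_or_lt with h | h
  · refine ⟨0, ρ₀, ρ₀, D s, le_rfl, hρ₀, hρ₀, ?_, fun _ => rfl, D_herm s, hS2, by rw [hSX, ← h]⟩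
    have h1 : p = 0 := by
      ext i
      exact (Finset.sum_eq_zero_iff_of_nonneg fun i _ => hp0 i).1 h.symm i (Finset.mem_univ _)
    have h2 : m = 0 := by
      ext i
      exact (Finset.sum_eq_zero_iff_of_nonneg fun i _ => hm0 i).1 (hsum ▸ h.symm) i
        (Finset.mem_univ _)
    rw [hXD, ← hpm, h1, h2]
    simp [D]
  · have hstate : ∀ f : b → ℝ, (∀ i, 0 ≤ f i) → ∑ i, f i = c → IsState (D (c⁻¹ • f)) := by
      intro f hf hfc
      refine ⟨D_psd _ fun i => mul_nonneg (inv_nonneg.2 hc0) (hf i), ?_⟩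
      rw [D_trace]
      simp only [Pi.smul_apply, smul_eq_mul, ← Finset.mul_sum, hfc, inv_mul_cancel₀ h.ne',
        Complex.ofReal_one]
    refine ⟨c, D (c⁻¹ • p), D (c⁻¹ • m), D s, hc0, hstate p hp0 rfl, hstate m hm0 hsum.symm, ?_,
      fun h0 => absurd h0 h.ne', D_herm s, hS2, hSX⟩
    rw [D_sub, ← smul_sub, hpm, ← D_smul, smul_smul, mul_inv_cancel₀ h.ne', one_smul, hXD]

/-- Marton's transportation inequality for the quantum Wasserstein distance. -/
theorem exists_hasSiteCosts_of_isLog {a : Type*} [Fintype a] [DecidableEq a] {σ g : Matrix a a ℂ}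
    (hσ : IsState σ) (hg : IsLog σ g) (n : ℕ) :
    ∃ G, IsLog (tensorPower n σ) G ∧ ∀ A H : Matrix (Fin n → a) (Fin n → a) ℂ, IsState A →
      IsLog A H → ∃ c : Fin n → ℝ, HasSiteCosts c A (tensorPower n σ) ∧
        ∑ i, c i ^ 2 ≤ (A * (H - G)).trace.re / 2 := by
  have hne : Nonempty a := by
    by_contra h
    rw [not_nonempty_iff] at h
    have := hσ.2
    simp [Matrix.trace] at this
  induction n with
  | zero =>
    have h1 : IsLog (tensorPower 0 σ) (0 : Matrix (Fin 0 → a) (Fin 0 → a) ℂ) := by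
      refine ⟨1, 0, by simp, by simp, ?_, by simp⟩
      ext x y
      simp [tensorPower, Subsingleton.elim x y]
    refine ⟨0, h1, fun A H hA hH => ⟨fun _ => 0, HasSiteCosts.refl hA
      (hA.eq_of_subsingleton (hσ.tensorPower 0)), ?_⟩⟩
    -- Pinsker's inequality with S = 1 serves only to show that the relative entropy is nonnegative.
    have := hH.pinsker h1 hA.2 (hσ.tensorPower 0).2 Matrix.isHermitian_one (one_mul _)
    simp only [ne_eq, OfNat.ofNat_ne_zero, not_false_eq_true, zero_pow, Finset.sum_const_zero]
    have h2 := sq_nonneg (1 * (A - tensorPower 0 σ)).trace.re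
    linarith
  | succ n ih =>
    obtain ⟨G, hG, ih⟩ := ih
    refine ⟨appendSite G 1 + appendSite 1 g, tensorPower_succ n σ ▸ hG.appendSite hg,
      fun A H hA hH => ?_⟩
    obtain ⟨H', hH'⟩ := hH.posDef.traceLast.exists_isLog
    obtain ⟨c, hc, hcs⟩ := ih _ _ hA.traceLast hH'
    have hB := hA.traceLast.appendSite hσ
    have hAB : (A - appendSite (traceLast A) σ).trace = 0 := by
      rw [Matrix.trace_sub, hA.2, hB.2, sub_self]
    obtain ⟨e, τ, η, S, he, hτ, hη, hX, he0, hS, hS2, hSX⟩ :=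
      (hA.1.isHermitian.sub hB.1.isHermitian).exists_jordan_decomposition hAB hA
    have hτη : traceLast τ = traceLast η := by
      rcases he.eq_or_lt with h | h
      · rw [he0 h.symm]
      · have h1 : traceLast (A - appendSite (traceLast A) σ) = 0 := by
          have : traceLast (A - appendSite (traceLast A) σ) =
              traceLast A - traceLast (appendSite (traceLast A) σ) := by
            ext x y
            simp [traceLast, Finset.sum_sub_distrib]
          rw [this, traceLast_appendSite, hσ.2, one_smul, sub_self]
        have h2 : traceLast ((e : ℂ) • (τ - η)) = (e : ℂ) • (traceLast τ - traceLast η) := by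
          ext x y
          simp [traceLast, Finset.sum_sub_distrib, ← Finset.mul_sum]
        rw [hX, h2, smul_eq_zero] at h1
        exact sub_eq_zero.1 (h1.resolve_left (by exact_mod_cast h.ne'))
    refine ⟨Fin.snoc c e, hc.snoc hσ he hτ hη hτη ?_, ?_⟩
    · rw [← hX, appendSite_sub_left, tensorPower_succ]
      abel
    -- With Tr(SX) = 2e, Pinsker's inequality reads 2e² ≤ D(A ‖ A' ⊗ σ), where A' is the marginal of
    -- A on the first n sites.
    · have hp := hH.pinsker (hH'.appendSite hg) hA.2 hB.2 hS hS2
      rw [hSX] at hp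
      -- Chain rule D(A ‖ σ^{⊗(n+1)}) = D(A ‖ A' ⊗ σ) + D(A' ‖ σ^{⊗n}): the terms 1 ⊗ `g` cancel.
      have hchain : (A * (H - (appendSite G 1 + appendSite 1 g))).trace =
          (A * (H - (appendSite H' 1 + appendSite 1 g))).trace +
            (traceLast A * (H' - G)).trace := by
        rw [← trace_mul_appendSite_one, ← Matrix.trace_add, ← Matrix.mul_add, appendSite_sub_left]
        congr 2
        abel
      rw [hchain, Complex.add_re, Fin.sum_univ_castSucc]
      simp only [Fin.snoc_castSucc, Fin.snoc_last]
      nlinarith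

/-! ### Tensor powers -/

section

variable {b : Type*} {n : ℕ}

theorem tensorPower_mul [Fintype b] (A B : Matrix b b ℂ) :
    tensorPower n (A * B) = tensorPower n A * tensorPower n B := by
  ext x y
  simp only [tensorPower, Matrix.mul_apply, Matrix.of_apply, Fintype.prod_sum,
    Finset.prod_mul_distrib]

theorem tensorPower_conjTranspose (A : Matrix b b ℂ) :
    tensorPower n A.conjTranspose = (tensorPower n A).conjTranspose := by
  ext x y
  simp [tensorPower, Matrix.conjTranspose_apply]

theorem tensorPower_diagonal [DecidableEq b] (f : b → ℂ) :
    tensorPower n (Matrix.diagonal f) = Matrix.diagonal fun x => ∏ i, f (x i) := by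
  ext x y
  simp only [tensorPower, Matrix.of_apply, Matrix.diagonal_apply]
  split_ifs with h
  · subst h
    simp
  · obtain ⟨i, hi⟩ := Function.ne_iff.1 h
    exact Finset.prod_eq_zero (Finset.mem_univ i) (by simp [hi])

theorem tensorPower_one [DecidableEq b] : tensorPower n (1 : Matrix b b ℂ) = 1 := by
  rw [← Matrix.diagonal_one, tensorPower_diagonal]
  simp

/-- The relation -A ≤ B ≤ A fails to be the right one to iterate, but -B ≤ A ≤ B is stable under
tensor products: B⊗B' ± A⊗A' is half the sum of (B+A)⊗(B'±A') and (B-A)⊗(B'∓A'). Both signs must be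
carried through the induction. -/
theorem tensorPower_add_sub_posSemidef [Fintype b] {A B : Matrix b b ℂ}
    (hadd : (B + A).PosSemidef) (hsub : (B - A).PosSemidef) (n : ℕ) :
    (tensorPower n B + tensorPower n A).PosSemidef ∧
      (tensorPower n B - tensorPower n A).PosSemidef := by
  induction n with
  | zero =>
    have h : ∀ C : Matrix b b ℂ, tensorPower 0 C = (Matrix.of fun _ _ => 1) := by
      intro C
      ext x y
      simp [tensorPower]
    classical
    have h1 : (Matrix.of fun _ _ => 1 : Matrix (Fin 0 → b) (Fin 0 → b) ℂ) = 1 := by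
      ext x y
      rw [Subsingleton.elim x y, Matrix.one_apply_eq, Matrix.of_apply]
    rw [h, h, sub_self, h1]
    exact ⟨Matrix.PosSemidef.one.add Matrix.PosSemidef.one, Matrix.PosSemidef.zero⟩
  | succ n ih =>
    obtain ⟨h1, h2⟩ := ih
    have h12 : (0 : ℂ) ≤ 1 / 2 := by positivity
    have e1 : tensorPower (n + 1) B + tensorPower (n + 1) A = (1 / 2 : ℂ) •
        (appendSite (tensorPower n B + tensorPower n A) (B + A) +
          appendSite (tensorPower n B - tensorPower n A) (B - A)) := by
      rw [tensorPower_succ, tensorPower_succ]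
      ext x y
      simp only [appendSite, Matrix.add_apply, Matrix.sub_apply, Matrix.smul_apply,
        Matrix.of_apply, smul_eq_mul]
      ring
    have e2 : tensorPower (n + 1) B - tensorPower (n + 1) A = (1 / 2 : ℂ) •
        (appendSite (tensorPower n B + tensorPower n A) (B - A) +
          appendSite (tensorPower n B - tensorPower n A) (B + A)) := by
      rw [tensorPower_succ, tensorPower_succ]
      ext x y
      simp only [appendSite, Matrix.add_apply, Matrix.sub_apply, Matrix.smul_apply,
        Matrix.of_apply, smul_eq_mul]
      ring
    rw [e1, e2]
    exact ⟨((h1.appendSite hadd).add (h2.appendSite hsub)).smul h12,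
      ((h1.appendSite hsub).add (h2.appendSite hadd)).smul h12⟩

theorem star_dotProduct_mulVec_eq_sum [Fintype b] (M : Matrix b b ℂ) (v : b → ℂ) :
    star v ⬝ᵥ M.mulVec v = ∑ x, ∑ y, star (v x) * M x y * v y := by
  simp only [dotProduct, Matrix.mulVec, Pi.star_apply, Finset.mul_sum, mul_assoc]

end

/-! ### Partial transposition -/

section

variable {a e : Type*} [Fintype a] [Fintype e] {n : ℕ}

theorem sum_arrow_prod {M : Type*} [AddCommMonoid M] (F : (Fin n → a × e) → M) :
    ∑ u, F u = ∑ x : Fin n → a, ∑ k : Fin n → e, F fun i => (x i, k i) := by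
  rw [← (Equiv.arrowProdEquivProdArrow (Fin n) (fun _ => a) fun _ => e).symm.sum_comp,
    Fintype.sum_prod_type]
  rfl

variable [DecidableEq e]

/-- `Tr_E |ψ⟩⟨ψ| ⊗ 1` dominates both signs of the partial transpose of `|ψ⟩⟨ψ|`. -/
theorem traceRight_ketBra_partialTranspose_posSemidef (ψ : a × e → ℂ) :
    ((Matrix.of fun u u' : a × e => traceRight (ketBra ψ) u.1 u'.1 * (1 : Matrix e e ℂ) u.2 u'.2) +
      Matrix.of fun u u' : a × e => ψ (u.1, u'.2) * star (ψ (u'.1, u.2))).PosSemidef ∧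
    ((Matrix.of fun u u' : a × e => traceRight (ketBra ψ) u.1 u'.1 * (1 : Matrix e e ℂ) u.2 u'.2) -
      Matrix.of fun u u' : a × e => ψ (u.1, u'.2) * star (ψ (u'.1, u.2))).PosSemidef := by
  -- `L` and `L'` differ by the swap of E ⊗ E. Both have Gram matrix `R` and their mixed products
  -- equal `F`, so R ± F = ½(L ± L')†(L ± L').
  let L : Matrix (e × e) (a × e) ℂ :=
    Matrix.of fun k u => star (ψ (u.1, k.1)) * (1 : Matrix e e ℂ) k.2 u.2
  let L' : Matrix (e × e) (a × e) ℂ :=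
    Matrix.of fun k u => star (ψ (u.1, k.2)) * (1 : Matrix e e ℂ) k.1 u.2
  set R := Matrix.of fun u u' : a × e =>
    traceRight (ketBra ψ) u.1 u'.1 * (1 : Matrix e e ℂ) u.2 u'.2 with hR
  set F := Matrix.of fun u u' : a × e => ψ (u.1, u'.2) * star (ψ (u'.1, u.2)) with hF
  have h1 : L.conjTranspose * L = R := by
    ext u u'
    simp [L, R, Matrix.mul_apply, Fintype.sum_prod_type, Matrix.one_apply, traceRight, ketBra,
      Matrix.vecMulVec_apply]
    split_ifs <;> simp_all
  have h2 : L'.conjTranspose * L' = R := by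
    ext u u'
    simp [L', R, Matrix.mul_apply, Fintype.sum_prod_type, Matrix.one_apply, traceRight, ketBra,
      Matrix.vecMulVec_apply]
    split_ifs <;> simp_all
  have h3 : L.conjTranspose * L' = F := by
    ext u u'
    simp [L, L', F, Matrix.mul_apply, Fintype.sum_prod_type, Matrix.one_apply,
      apply_ite (starRingEnd ℂ)]
  have h4 : L'.conjTranspose * L = F := by
    ext u u'
    simp [L, L', F, Matrix.mul_apply, Fintype.sum_prod_type, Matrix.one_apply,
      apply_ite (starRingEnd ℂ)]
  have h12 : (0 : ℂ) ≤ 1 / 2 := by positivity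
  have e1 : R + F = (1 / 2 : ℂ) • ((L + L').conjTranspose * (L + L')) := by
    rw [Matrix.conjTranspose_add, Matrix.add_mul, Matrix.mul_add, Matrix.mul_add, h1, h2, h3, h4]
    module
  have e2 : R - F = (1 / 2 : ℂ) • ((L - L').conjTranspose * (L - L')) := by
    rw [Matrix.conjTranspose_sub, Matrix.sub_mul, Matrix.mul_sub, Matrix.mul_sub, h1, h2, h3, h4]
    module
  rw [e1, e2]
  exact ⟨(Matrix.posSemidef_conjTranspose_mul_self _).smul h12,
    (Matrix.posSemidef_conjTranspose_mul_self _).smul h12⟩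

/-- On α ⊗ w an operator has the same expectation as its partial transpose on α ⊗ w̄. The partial
transpose of the left operator is a tensor power that is dominated by the tensor power of (y·1 + z
Tr_E|ψ⟩⟨ψ|) ⊗ 1. Here α and w may be entangled across the n sites. -/
theorem product_vector_tensorPower_le [DecidableEq a] (ψ : a × e → ℂ) {y z : ℝ} (hy : 0 ≤ y) (hz : 0 ≤ z)
    (α : (Fin n → a) → ℂ) (w : (Fin n → e) → ℂ) :
    star (fun u : Fin n → a × e => α (fun i => (u i).1) * w (fun i => (u i).2)) ⬝ᵥ
      (tensorPower n ((y : ℂ) • 1 + (z : ℂ) • ketBra ψ)).mulVec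
        (fun u : Fin n → a × e => α (fun i => (u i).1) * w (fun i => (u i).2)) ≤
    (star α ⬝ᵥ (tensorPower n ((y : ℂ) • 1 + (z : ℂ) • traceRight (ketBra ψ))).mulVec α) *
      ∑ k, star (w k) * w k := by
  obtain ⟨hadd, hsub⟩ := traceRight_ketBra_partialTranspose_posSemidef ψ
  set R := Matrix.of fun u u' : a × e =>
    traceRight (ketBra ψ) u.1 u'.1 * (1 : Matrix e e ℂ) u.2 u'.2 with hR
  set F := Matrix.of fun u u' : a × e => ψ (u.1, u'.2) * star (ψ (u'.1, u.2)) with hF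
  have hy' : (0 : ℂ) ≤ y := by exact_mod_cast hy
  have hz' : (0 : ℂ) ≤ z := by exact_mod_cast hz
  have h1 : (((y : ℂ) • 1 + (z : ℂ) • R) + ((y : ℂ) • 1 + (z : ℂ) • F)).PosSemidef := by
    have : ((y : ℂ) • 1 + (z : ℂ) • R) + ((y : ℂ) • 1 + (z : ℂ) • F) =
      ((y : ℂ) • 1 + (y : ℂ) • 1) + (z : ℂ) • (R + F) := by module
    rw [this]
    exact ((Matrix.PosSemidef.one.smul hy').add (Matrix.PosSemidef.one.smul hy')).add
      (hadd.smul hz')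
  have h2 : (((y : ℂ) • 1 + (z : ℂ) • R) - ((y : ℂ) • 1 + (z : ℂ) • F)).PosSemidef := by
    have : ((y : ℂ) • 1 + (z : ℂ) • R) - ((y : ℂ) • 1 + (z : ℂ) • F) = (z : ℂ) • (R - F) := by
      module
    rw [this]
    exact hsub.smul hz'
  have h3 := (tensorPower_add_sub_posSemidef h1 h2 n).2.dotProduct_mulVec_nonneg
    (fun u : Fin n → a × e => α (fun i => (u i).1) * star (w (fun i => (u i).2)))
  rw [Matrix.sub_mulVec, dotProduct_sub, sub_nonneg] at h3
  have hB : tensorPower n ((y : ℂ) • 1 + (z : ℂ) • R) = Matrix.of fun u u' =>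
      tensorPower n ((y : ℂ) • 1 + (z : ℂ) • traceRight (ketBra ψ)) (fun i => (u i).1)
        (fun i => (u' i).1) * (1 : Matrix (Fin n → e) (Fin n → e) ℂ) (fun i => (u i).2)
        (fun i => (u' i).2) := by
    ext u u'
    rw [← tensorPower_one]
    simp only [tensorPower, Matrix.of_apply, ← Finset.prod_mul_distrib]
    refine Finset.prod_congr rfl fun i _ => ?_
    simp only [hR, Matrix.add_apply, Matrix.smul_apply, Matrix.of_apply, smul_eq_mul,
      Matrix.one_apply, Prod.ext_iff]
    split_ifs <;> simp_all
  convert h3 using 1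
  · simp only [star_dotProduct_mulVec_eq_sum, sum_arrow_prod]
    -- Exchanging the two environment indices carries out the partial transposition.
    have hswap : ∀ f : (Fin n → a) → (Fin n → e) → (Fin n → a) → (Fin n → e) → ℂ,
        ∑ x, ∑ k, ∑ x', ∑ k', f x k x' k' = ∑ x, ∑ k, ∑ x', ∑ k', f x k' x' k := by
      intro f
      refine Finset.sum_congr rfl fun x _ => ?_
      calc _ = ∑ k, ∑ k', ∑ x', f x k x' k' :=
            Finset.sum_congr rfl fun k _ => Finset.sum_comm
        _ = ∑ k', ∑ k, ∑ x', f x k x' k' := Finset.sum_comm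
        _ = _ := Finset.sum_congr rfl fun k _ => Finset.sum_comm
    rw [hswap]
    refine Finset.sum_congr rfl fun x _ => Finset.sum_congr rfl fun k _ =>
      Finset.sum_congr rfl fun x' _ => Finset.sum_congr rfl fun k' _ => ?_
    have : tensorPower n ((y : ℂ) • 1 + (z : ℂ) • ketBra ψ) (fun i => (x i, k' i))
        (fun i => (x' i, k i)) = tensorPower n ((y : ℂ) • 1 + (z : ℂ) • F) (fun i => (x i, k i))
        (fun i => (x' i, k' i)) := by
      simp only [tensorPower, Matrix.of_apply]
      refine Finset.prod_congr rfl fun i _ => ?_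
      simp only [hF, ketBra, Matrix.vecMulVec_apply, Matrix.add_apply, Matrix.smul_apply,
        Matrix.of_apply, smul_eq_mul, Matrix.one_apply, Prod.ext_iff, Pi.star_apply,
        eq_comm (a := k i)]
    rw [this]
    simp only [star_mul', star_star]
    ring
  · rw [hB]
    simp only [star_dotProduct_mulVec_eq_sum, sum_arrow_prod, Matrix.of_apply, Finset.sum_mul]
    refine Finset.sum_congr rfl fun x _ => ?_
    simp only [Finset.mul_sum]
    rw [Finset.sum_comm]
    refine Finset.sum_congr rfl fun k _ => Finset.sum_congr rfl fun x' _ => ?_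
    rw [Finset.sum_eq_single k]
    · simp only [Matrix.one_apply_eq, star_mul', star_star]
      ring
    · intro k' _ hk
      simp [hk.symm]
    · simp

end

/-! ### Vectors with few defects -/

theorem sum_eq_zero_of_factor_site {b : Type*} [Fintype b] {n : ℕ} (k : Fin n)
    {f q : (Fin n → b) → ℂ} {g : b → ℂ} (hf : ∀ u, f u = g (u k) * q u)
    (hq : ∀ u t, q (Function.update u k t) = q u) (hg : ∑ t, g t = 0) : ∑ u, f u = 0 := by
  classical
  rw [← (Equiv.funSplitAt k b).symm.sum_comp, Fintype.sum_prod_type, Finset.sum_comm]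
  refine Finset.sum_eq_zero fun x _ => ?_
  rcases isEmpty_or_nonempty b with hb | ⟨⟨s₀⟩⟩
  · simp
  · have hupd : ∀ s, (Equiv.funSplitAt k b).symm (s, x) =
        Function.update ((Equiv.funSplitAt k b).symm (s₀, x)) k s := by
      intro s
      ext j
      by_cases hj : j = k
      · subst hj; simp [Equiv.funSplitAt, Equiv.piSplitAt]
      · simp [Equiv.funSplitAt, Equiv.piSplitAt, hj]
    have : ∀ s, f ((Equiv.funSplitAt k b).symm (s, x)) =
        g s * q ((Equiv.funSplitAt k b).symm (s₀, x)) := by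
      intro s
      rw [hf, hupd, hq, Function.update_self]
    rw [Finset.sum_congr rfl fun s _ => this s, ← Finset.sum_mul, hg, zero_mul]

section

variable {b : Type*} [Fintype b] [DecidableEq b]

theorem exists_unitary_column {ψ : b → ℂ} (hψ : ∑ x, ‖ψ x‖ ^ 2 = 1) :
    ∃ (W : Matrix b b ℂ) (i₀ : b), W.conjTranspose * W = 1 ∧ W * W.conjTranspose = 1 ∧
      ∀ u, W u i₀ = ψ u := by
  have hne : Nonempty b := by
    by_contra h
    rw [not_nonempty_iff] at h
    simp at hψ
  obtain ⟨i₀⟩ := hne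
  have hnorm : ‖(WithLp.toLp 2 ψ : EuclideanSpace ℂ b)‖ = 1 := by
    rw [EuclideanSpace.norm_eq, hψ, Real.sqrt_one]
  obtain ⟨β, hβ⟩ := Orthonormal.exists_orthonormalBasis_extension_of_card_eq
    (𝕜 := ℂ) (E := EuclideanSpace ℂ b) (ι := b) (by simp)
    (v := fun _ => WithLp.toLp 2 ψ) (s := {i₀}) (by
      constructor
      · intro i; exact hnorm
      · intro i j hij
        exact absurd (Subsingleton.elim i j) hij)
  have hW : (Matrix.of fun u i => β i u : Matrix b b ℂ).conjTranspose *
      (Matrix.of fun u i => β i u) = 1 := by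
    ext i j
    have := orthonormal_iff_ite.1 β.orthonormal i j
    rw [EuclideanSpace.inner_eq_star_dotProduct] at this
    simp only [Matrix.mul_apply, Matrix.conjTranspose_apply, Matrix.of_apply, Matrix.one_apply]
    rw [← this, dotProduct]
    exact Finset.sum_congr rfl fun u _ => mul_comm _ _
  refine ⟨Matrix.of fun u i => β i u, i₀, hW, mul_eq_one_comm.1 hW, fun u => ?_⟩
  simp [hβ i₀ rfl]

/-- If more than r entries of `s` differ from `i₀`, one of them sits at a site carrying ψ, by
pigeonhole. The sum over that site is the inner product of ψ with another column of `W`, hence 0. -/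
theorem coefficient_defectVectors_eq_zero {n r : ℕ} (hr : r ≤ n) {ψ : b → ℂ} {W : Matrix b b ℂ}
    {i₀ : b} (hW : W.conjTranspose * W = 1) (hψ : ∀ u, W u i₀ = ψ u) {v : (Fin n → b) → ℂ}
    (hv : v ∈ Submodule.span ℂ (defectVectors hr ψ)) {s : Fin n → b}
    (hs : r < (Finset.univ.filter fun i => s i ≠ i₀).card) :
    ((tensorPower n W).conjTranspose.mulVec v) s = 0 := by
  induction hv using Submodule.span_induction with
  | zero => simp
  | add v w _ _ hv hw => rw [Matrix.mulVec_add, Pi.add_apply, hv, hw, add_zero]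
  | smul c v _ hv => rw [Matrix.mulVec_smul, Pi.smul_apply, hv, smul_zero]
  | mem v hv =>
    obtain ⟨π, ω, rfl⟩ := hv
    obtain ⟨j, hj⟩ : ∃ j : Fin (n - r), s (π ⟨j, by omega⟩) ≠ i₀ := by
      by_contra! hcon
      have hsub : (Finset.univ.filter fun i => s i ≠ i₀) ⊆
          Finset.univ.image fun j : Fin r => π ⟨n - r + j, by omega⟩ := by
        intro i hi
        rw [Finset.mem_filter] at hi
        rw [Finset.mem_image]
        by_cases h : (π.symm i : ℕ) < n - r
        · refine absurd ?_ hi.2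
          have := hcon ⟨π.symm i, h⟩
          simpa using this
        · refine ⟨⟨(π.symm i : ℕ) - (n - r), by omega⟩, Finset.mem_univ _, ?_⟩
          rw [← Equiv.eq_symm_apply]
          ext
          simp only
          omega
      have := (Finset.card_le_card hsub).trans Finset.card_image_le
      rw [Finset.card_univ, Fintype.card_fin] at this
      omega
    set k : Fin n := π ⟨j, by omega⟩ with hk
    have hperm : ∀ u : Fin n → b, (permUnitary π).mulVec (withDefects hr ψ ω) u =
        withDefects hr ψ ω (u ∘ π) := by
      intro u
      simp [Matrix.mulVec, dotProduct, permUnitary]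
    rw [Matrix.mulVec, dotProduct]
    refine sum_eq_zero_of_factor_site k
      (g := fun t => star (W t (s k)) * ψ t)
      (q := fun u => (∏ i ∈ Finset.univ.erase k, star (W (u i) (s i))) *
        ((∏ i ∈ Finset.univ.erase j, ψ (u (π ⟨i, by omega⟩))) *
          ω fun l => u (π ⟨n - r + l, by omega⟩))) ?_ ?_ ?_
    · intro u
      rw [hperm, withDefects, Matrix.conjTranspose_apply, tensorPower, Matrix.of_apply,
        Complex.star_def, map_prod, ← Finset.mul_prod_erase _ _ (Finset.mem_univ k),
        ← Finset.mul_prod_erase _ _ (Finset.mem_univ j)]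
      simp only [Function.comp_apply, ← hk]
      ring
    · intro u t
      have h1 : ∏ i ∈ Finset.univ.erase k, star (W (Function.update u k t i) (s i)) =
          ∏ i ∈ Finset.univ.erase k, star (W (u i) (s i)) :=
        Finset.prod_congr rfl fun i hi => by
          rw [Function.update_of_ne (Finset.ne_of_mem_erase hi)]
      have h2 : ∏ i ∈ Finset.univ.erase j, ψ (Function.update u k t (π ⟨i, by omega⟩)) =
          ∏ i ∈ Finset.univ.erase j, ψ (u (π ⟨i, by omega⟩)) :=
        Finset.prod_congr rfl fun i hi => by
          rw [Function.update_of_ne]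
          intro h
          rw [hk, π.apply_eq_iff_eq, Fin.mk.injEq, ← Fin.ext_iff] at h
          exact Finset.ne_of_mem_erase hi h
      have h3 : (fun l : Fin r => Function.update u k t (π ⟨n - r + l, by omega⟩)) =
          fun l : Fin r => u (π ⟨n - r + l, by omega⟩) := by
        ext l
        rw [Function.update_of_ne]
        intro h
        rw [hk, π.apply_eq_iff_eq, Fin.mk.injEq] at h
        omega
      rw [h1, h2, h3]
    · have := congrFun (congrFun hW (s k)) i₀
      rw [Matrix.one_apply_ne hj, Matrix.mul_apply] at this
      simpa [Matrix.conjTranspose_apply, hψ] using this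

/-- This is |v⟩⟨v| ≤ K‖v‖² Y^{⊗n} as quadratic forms, with Y = y·1 + (p-y)|ψ⟩⟨ψ|. In the product
basis extending ψ, Y^{⊗n} is diagonal with entries p^{n-k}y^k, where k counts the defects, and v
lives on k ≤ r; weighted Cauchy–Schwarz does the rest. -/
theorem normSq_dotProduct_le_of_mem_span {n r : ℕ} (hr : r ≤ n) {ψ : b → ℂ}
    (hψ : ∑ x, ‖ψ x‖ ^ 2 = 1) {p y K : ℝ} (hy : 0 ≤ y) (hyp : y ≤ p) (hK0 : 0 ≤ K)
    (hK : ∀ k ≤ r, 1 ≤ K * (p ^ (n - k) * y ^ k)) {v : (Fin n → b) → ℂ}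
    (hv : v ∈ Submodule.span ℂ (defectVectors hr ψ)) (f : (Fin n → b) → ℂ) :
    ‖star f ⬝ᵥ v‖ ^ 2 ≤ (∑ u, ‖v u‖ ^ 2) * (K * (star f ⬝ᵥ
      (tensorPower n ((y : ℂ) • 1 + ((p - y : ℝ) : ℂ) • ketBra ψ)).mulVec f).re) := by
  obtain ⟨W, i₀, hW, hW', hWψ⟩ := exists_unitary_column hψ
  set T := tensorPower n W with hT
  have hT1 : T * T.conjTranspose = 1 := by
    rw [hT, ← tensorPower_conjTranspose, ← tensorPower_mul, hW', tensorPower_one]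
  set d : b → ℝ := fun i => if i = i₀ then p else y with hd
  have hY : (y : ℂ) • 1 + ((p - y : ℝ) : ℂ) • ketBra ψ =
      W * Matrix.diagonal (fun i => (d i : ℂ)) * W.conjTranspose := by
    have h1 : (Matrix.diagonal fun i => (d i : ℂ)) =
        (y : ℂ) • 1 + ((p - y : ℝ) : ℂ) • Matrix.single i₀ i₀ 1 := by
      ext i j
      simp only [Matrix.diagonal_apply, Matrix.add_apply, Matrix.smul_apply, Matrix.one_apply,
        Matrix.single_apply, hd, smul_eq_mul]
      by_cases hij : i = j
      · subst hij
        by_cases h : i = i₀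
        · subst h; simp
        · simp [h, Ne.symm h]
      · have : ¬ (i₀ = i ∧ i₀ = j) := fun h => hij (h.1.symm.trans h.2)
        simp [hij, this]
    have h2 : W * Matrix.single i₀ i₀ 1 * W.conjTranspose = ketBra ψ := by
      ext u u'
      rw [Matrix.mul_apply, Finset.sum_eq_single i₀]
      · simp [ketBra, Matrix.vecMulVec_apply, hWψ]
      · intro j _ hj
        simp [Matrix.mul_single_apply_of_ne, hj]
      · simp
    rw [h1, Matrix.mul_add, Matrix.add_mul, Matrix.mul_smul, Matrix.mul_smul, Matrix.smul_mul,
      Matrix.smul_mul, Matrix.mul_one, hW', h2]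
  have hYn : tensorPower n ((y : ℂ) • 1 + ((p - y : ℝ) : ℂ) • ketBra ψ) =
      T * Matrix.diagonal (fun s => ((∏ i, d (s i) : ℝ) : ℂ)) * T.conjTranspose := by
    rw [hY, tensorPower_mul, tensorPower_mul, tensorPower_conjTranspose, tensorPower_diagonal]
    push_cast
    rfl
  set f' := T.conjTranspose.mulVec f with hf'
  set v' := T.conjTranspose.mulVec v with hv'
  have hinner : ∀ g h : (Fin n → b) → ℂ,
      star (T.conjTranspose.mulVec g) ⬝ᵥ T.conjTranspose.mulVec h = star g ⬝ᵥ h := by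
    intro g h
    rw [Matrix.star_mulVec, Matrix.conjTranspose_conjTranspose, ← Matrix.dotProduct_mulVec,
      Matrix.mulVec_mulVec, hT1, Matrix.one_mulVec]
  have hns : ∀ {ι : Type _} [Fintype ι] (g : ι → ℂ), star g ⬝ᵥ g = ((∑ u, ‖g u‖ ^ 2 : ℝ) : ℂ) := by
    intro ι _ g
    simp only [dotProduct, Pi.star_apply, Complex.star_def, Complex.conj_mul']
    push_cast
    rfl
  have hq : (star f ⬝ᵥ (tensorPower n ((y : ℂ) • 1 + ((p - y : ℝ) : ℂ) • ketBra ψ)).mulVec f).re =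
      ∑ s, (∏ i, d (s i)) * ‖f' s‖ ^ 2 := by
    have : star f ⬝ᵥ (tensorPower n ((y : ℂ) • 1 + ((p - y : ℝ) : ℂ) • ketBra ψ)).mulVec f =
        star f' ⬝ᵥ (Matrix.diagonal (fun s => ((∏ i, d (s i) : ℝ) : ℂ))).mulVec f' := by
      rw [hYn, hf', Matrix.star_mulVec, Matrix.conjTranspose_conjTranspose,
        ← Matrix.dotProduct_mulVec, Matrix.mulVec_mulVec, Matrix.mulVec_mulVec, Matrix.mul_assoc]
    rw [this]
    simp only [dotProduct, Matrix.mulVec_diagonal, Pi.star_apply, Complex.re_sum]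
    refine Finset.sum_congr rfl fun s _ => ?_
    rw [mul_left_comm, Complex.star_def, Complex.conj_mul', Complex.re_ofReal_mul]
    norm_cast
  have hvn : ∑ u, ‖v u‖ ^ 2 = ∑ s, ‖v' s‖ ^ 2 := by
    have := hinner v v
    rw [hns, hns] at this
    exact_mod_cast this.symm
  have hgood : ∀ s, ‖f' s‖ * ‖v' s‖ ≤ Real.sqrt (K * ((∏ i, d (s i)) * ‖f' s‖ ^ 2)) * ‖v' s‖ := by
    intro s
    by_cases hs : r < (Finset.univ.filter fun i => s i ≠ i₀).card
    · rw [hv', coefficient_defectVectors_eq_zero hr hW hWψ hv hs]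
      simp
    · refine mul_le_mul_of_nonneg_right (Real.le_sqrt_of_sq_le ?_) (norm_nonneg _)
      have hcard := Finset.card_filter_add_card_filter_not (s := Finset.univ) (fun i => s i = i₀)
      rw [Finset.card_univ, Fintype.card_fin] at hcard
      have hprod : ∏ i, d (s i) = p ^ (n - (Finset.univ.filter fun i => s i ≠ i₀).card) *
          y ^ (Finset.univ.filter fun i => s i ≠ i₀).card := by
        simp only [hd]
        rw [Finset.prod_ite, Finset.prod_const, Finset.prod_const]
        congr 2
        change _ + (Finset.univ.filter fun i => s i ≠ i₀).card = n at hcard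
        omega
      have := hK _ (not_lt.1 hs)
      rw [← hprod] at this
      calc ‖f' s‖ ^ 2 = 1 * ‖f' s‖ ^ 2 := (one_mul _).symm
        _ ≤ (K * ∏ i, d (s i)) * ‖f' s‖ ^ 2 := by gcongr
        _ = _ := by ring
  have hd0 : ∀ i, 0 ≤ d i := by
    intro i
    simp only [hd]
    split_ifs
    · exact hy.trans hyp
    · exact hy
  rw [← hinner f v, hq, hvn]
  calc ‖star f' ⬝ᵥ v'‖ ^ 2 ≤
      (∑ s, Real.sqrt (K * ((∏ i, d (s i)) * ‖f' s‖ ^ 2)) * ‖v' s‖) ^ 2 := by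
        refine pow_le_pow_left₀ (norm_nonneg _) ?_ 2
        rw [dotProduct]
        refine (norm_sum_le _ _).trans (Finset.sum_le_sum fun s _ => ?_)
        rw [norm_mul, Pi.star_apply, norm_star]
        exact hgood s
    _ ≤ (∑ s, Real.sqrt (K * ((∏ i, d (s i)) * ‖f' s‖ ^ 2)) ^ 2) * ∑ s, ‖v' s‖ ^ 2 :=
        Finset.sum_mul_sq_le_sq_mul_sq _ _ _
    _ = _ := by
        rw [mul_comm]
        congr 1
        rw [Finset.mul_sum]
        refine Finset.sum_congr rfl fun s _ => Real.sq_sqrt ?_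
        have := Finset.prod_nonneg fun i (_ : i ∈ Finset.univ) => hd0 (s i)
        positivity

end

/-! ### The operator inequality -/

/-- Eigenvectors of nonzero eigenvalue lie in the range, so the support condition on a mixed state
passes to each pure component. -/
theorem exists_spectral_sum {b : Type*} [Fintype b] [DecidableEq b] {T : Matrix b b ℂ}
    (hT : IsState T) : ∃ (l : b → ℝ) (v : b → b → ℂ), (∀ i, 0 ≤ l i) ∧ ∑ i, l i = 1 ∧
      (∀ i, ∑ u, ‖v i u‖ ^ 2 = 1) ∧ (∀ i, l i ≠ 0 → v i ∈ LinearMap.range T.mulVecLin) ∧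
      ∀ x y, T x y = ∑ i, (l i : ℂ) * (v i x * star (v i y)) := by
  obtain ⟨U, hU, hU', hTU⟩ := hT.1.isHermitian.exists_diagonalization
  set l := hT.1.isHermitian.eigenvalues
  refine ⟨l, fun i u => U u i, hT.1.eigenvalues_nonneg, ?_, ?_, ?_, ?_⟩
  · have := hT.2
    rw [hTU, Matrix.trace_mul_comm, ← Matrix.mul_assoc, hU, Matrix.one_mul,
      Matrix.trace_diagonal] at this
    exact_mod_cast this
  · intro i
    have := congrFun (congrFun hU i) i
    rw [Matrix.mul_apply, Matrix.one_apply_eq] at this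
    simp only [Matrix.conjTranspose_apply, Complex.star_def, Complex.conj_mul'] at this
    exact_mod_cast this
  · intro i hi
    refine ⟨fun u => (l i : ℂ)⁻¹ * U u i, ?_⟩
    have h1 : T * U = U * Matrix.diagonal (fun i => (l i : ℂ)) := by
      conv_lhs => rw [hTU]
      rw [Matrix.mul_assoc, hU, Matrix.mul_one]
    ext x
    have h2 := congrFun (congrFun h1 x) i
    rw [Matrix.mul_apply, Matrix.mul_diagonal] at h2
    have h3 : (l i : ℂ) ≠ 0 := by exact_mod_cast hi
    have h4 : ∑ u, T x u * ((l i : ℂ)⁻¹ * U u i) = (l i : ℂ)⁻¹ * ∑ u, T x u * U u i := by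
      rw [Finset.mul_sum]
      exact Finset.sum_congr rfl fun u _ => by ring
    rw [Matrix.mulVecLin_apply, Matrix.mulVec, dotProduct, h4, h2]
    field_simp
  · intro x y
    conv_lhs => rw [hTU]
    rw [Matrix.mul_apply]
    refine Finset.sum_congr rfl fun i _ => ?_
    rw [Matrix.mul_diagonal, Matrix.conjTranspose_apply]
    ring

/-- The left side N is the expectation in α of the marginal of |v⟩⟨v|. With w the contraction of v
with α, the overlap of α ⊗ w with v is N = ‖w‖², so the two preceding bounds give N² ≤ K · N · ⟨α,
σ^{⊗n} α⟩, and N cancels. -/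
theorem sum_norm_sq_marginal_le {a e : Type*} [Fintype a] [Fintype e] [DecidableEq a]
    [DecidableEq e] {n r : ℕ} (hr : r ≤ n) {ψ : a × e → ℂ} (hψ : ∑ x, ‖ψ x‖ ^ 2 = 1) {p y K : ℝ}
    (hy : 0 ≤ y) (hyp : y ≤ p) (hK0 : 0 ≤ K) (hK : ∀ k ≤ r, 1 ≤ K * (p ^ (n - k) * y ^ k))
    {v : (Fin n → a × e) → ℂ} (hv : v ∈ Submodule.span ℂ (defectVectors hr ψ))
    (hv1 : ∑ u, ‖v u‖ ^ 2 = 1) (α : (Fin n → a) → ℂ) :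
    ∑ z : Fin n → e, ‖∑ x : Fin n → a, star (α x) * v fun i => (x i, z i)‖ ^ 2 ≤
      K * (star α ⬝ᵥ (tensorPower n ((y : ℂ) • 1 +
        ((p - y : ℝ) : ℂ) • traceRight (ketBra ψ))).mulVec α).re := by
  set w : (Fin n → e) → ℂ := fun z => ∑ x : Fin n → a, star (α x) * v fun i => (x i, z i) with hw
  set N := ∑ z, ‖w z‖ ^ 2 with hN
  set A := star α ⬝ᵥ (tensorPower n ((y : ℂ) • 1 +
        ((p - y : ℝ) : ℂ) • traceRight (ketBra ψ))).mulVec α with hA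
  have hN0 : 0 ≤ N := Finset.sum_nonneg fun z _ => by positivity
  have hww : ∑ k, star (w k) * w k = (N : ℂ) := by
    simp only [Complex.star_def, Complex.conj_mul', hN]
    push_cast
    rfl
  have h1 := product_vector_tensorPower_le ψ hy (sub_nonneg.2 hyp) α w
  have h2 := normSq_dotProduct_le_of_mem_span hr hψ hy hyp hK0 hK hv
    (fun u : Fin n → a × e => α (fun i => (u i).1) * w (fun i => (u i).2))
  have h3 : star (fun u : Fin n → a × e => α (fun i => (u i).1) * w (fun i => (u i).2)) ⬝ᵥ v =
      (N : ℂ) := by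
    rw [dotProduct, sum_arrow_prod, Finset.sum_comm, ← hww]
    refine Finset.sum_congr rfl fun z _ => ?_
    conv_rhs => rw [hw]
    simp only [Finset.mul_sum, Pi.star_apply, star_mul']
    refine Finset.sum_congr rfl fun x _ => ?_
    ring
  rw [h3, hv1, one_mul, Complex.norm_real, Real.norm_of_nonneg hN0] at h2
  rw [hww, ← hA] at h1
  have h4 := (Complex.le_def.1 h1).1
  rw [mul_comm A, Complex.re_ofReal_mul] at h4
  have h5 : N ^ 2 ≤ K * (N * A.re) := h2.trans (mul_le_mul_of_nonneg_left h4 hK0)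
  -- For N = 0 nothing can be cancelled, but the right side is nonnegative.
  rcases hN0.eq_or_lt with h | h
  · have hσ : (tensorPower n ((y : ℂ) • 1 +
        ((p - y : ℝ) : ℂ) • traceRight (ketBra ψ))).PosSemidef := by
      have hs : ((y : ℂ) • 1 + ((p - y : ℝ) : ℂ) • traceRight (ketBra ψ)).PosSemidef := by
        refine (Matrix.PosSemidef.one.smul (by exact_mod_cast hy)).add
          (Matrix.PosSemidef.smul ?_ (by exact_mod_cast sub_nonneg.2 hyp))
        have : traceRight (ketBra ψ) =
            ∑ z, (ketBra ψ).submatrix (fun x => (x, z)) (fun x => (x, z)) := by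
          ext x y
          simp [traceRight, Matrix.sum_apply]
        rw [this]
        exact Matrix.posSemidef_sum _ fun z _ =>
          (Matrix.posSemidef_vecMulVec_self_star ψ).submatrix _
      -- With A = 0 the two conclusions add up to twice the tensor power of B, which is therefore
      -- positive.
      have := tensorPower_add_sub_posSemidef (A := 0) (by rwa [add_zero]) (by rwa [sub_zero]) n
      have h6 := (this.1.add this.2).smul (show (0 : ℂ) ≤ 1 / 2 by positivity)
      convert h6 using 1
      module
    rw [← h]
    exact mul_nonneg hK0 (Complex.le_def.1 (hσ.dotProduct_mulVec_nonneg α)).1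
  · have : N * N ≤ N * (K * A.re) := by linarith [h5, sq N]
    exact le_of_mul_le_mul_left this h

theorem IsMSRAlmostIID.posSemidef_sub {a : Type*} [Fintype a] [DecidableEq a] {n r : ℕ}
    {ρ : Matrix a a ℂ} {ρn : Matrix (Fin n → a) (Fin n → a) ℂ} (h : IsMSRAlmostIID n r ρ ρn)
    (hρ : ρ.IsHermitian) (hρn : ρn.IsHermitian) {p y K : ℝ} (hy : 0 ≤ y) (hyp : y ≤ p)
    (hK0 : 0 ≤ K) (hK : ∀ k ≤ r, 1 ≤ K * (p ^ (n - k) * y ^ k)) :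
    ((K : ℂ) • tensorPower n ((y : ℂ) • 1 + ((p - y : ℝ) : ℂ) • ρ) - ρn).PosSemidef := by
  obtain ⟨hr, m, ψ, τ, ⟨hψ, rfl⟩, hτ, rfl, -, hrange⟩ := h
  obtain ⟨l, v, hl, hl1, hv1, hvr, hτv⟩ := exists_spectral_sum hτ
  have hσ : (tensorPower n ((y : ℂ) • 1 + ((p - y : ℝ) : ℂ) • traceRight (ketBra ψ))).IsHermitian := by
    rw [Matrix.IsHermitian, ← tensorPower_conjTranspose, Matrix.conjTranspose_add,
      Matrix.conjTranspose_smul, Matrix.conjTranspose_smul, hρ.eq, Matrix.conjTranspose_one]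
    simp
  have hherm : ((K : ℂ) • tensorPower n ((y : ℂ) • 1 + ((p - y : ℝ) : ℂ) •
      traceRight (ketBra ψ)) - traceRightPower τ).IsHermitian := by
    rw [Matrix.IsHermitian, Matrix.conjTranspose_sub, Matrix.conjTranspose_smul, hσ.eq, hρn.eq]
    simp
  refine Matrix.PosSemidef.of_dotProduct_mulVec_nonneg hherm fun α => ?_
  rw [Complex.le_def]
  refine ⟨?_, (hherm.im_star_dotProduct_mulVec_self α).symm⟩
  rw [Matrix.sub_mulVec, dotProduct_sub, Matrix.smul_mulVec, dotProduct_smul, smul_eq_mul,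
    Complex.sub_re, Complex.re_ofReal_mul, Complex.zero_re, sub_nonneg]
  have hexp : star α ⬝ᵥ (traceRightPower τ).mulVec α = ((∑ i, l i * ∑ z : Fin n → Fin m,
      ‖∑ x : Fin n → a, star (α x) * v i fun j => (x j, z j)‖ ^ 2 : ℝ) : ℂ) := by
    have hcomm : ∀ F : (Fin n → a) → (Fin n → a) → (Fin n → Fin m) → (Fin n → a × Fin m) → ℂ,
        ∑ x, ∑ x', ∑ z, ∑ i, F x x' z i = ∑ i, ∑ z, ∑ x, ∑ x', F x x' z i := by
      intro F
      calc _ = ∑ x, ∑ z, ∑ x', ∑ i, F x x' z i :=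
            Finset.sum_congr rfl fun x _ => Finset.sum_comm
        _ = ∑ z, ∑ x, ∑ x', ∑ i, F x x' z i := Finset.sum_comm
        _ = ∑ z, ∑ x, ∑ i, ∑ x', F x x' z i :=
            Finset.sum_congr rfl fun z _ => Finset.sum_congr rfl fun x _ => Finset.sum_comm
        _ = ∑ z, ∑ i, ∑ x, ∑ x', F x x' z i :=
            Finset.sum_congr rfl fun z _ => Finset.sum_comm
        _ = _ := Finset.sum_comm
    push_cast
    simp only [← Complex.mul_conj', map_sum, map_mul, Complex.star_def, Complex.conj_conj,
      star_dotProduct_mulVec_eq_sum, traceRightPower, Matrix.of_apply, hτv,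
      Finset.mul_sum, Finset.sum_mul]
    rw [hcomm]
    refine Finset.sum_congr rfl fun i _ => Finset.sum_congr rfl fun z _ => ?_
    rw [Finset.sum_comm]
    refine Finset.sum_congr rfl fun x _ => Finset.sum_congr rfl fun x' _ => ?_
    ring
  rw [hexp, Complex.ofReal_re]
  calc _ ≤ ∑ i, l i * (K * (star α ⬝ᵥ (tensorPower n ((y : ℂ) • 1 +
        ((p - y : ℝ) : ℂ) • traceRight (ketBra ψ))).mulVec α).re) := by
        refine Finset.sum_le_sum fun i _ => ?_
        by_cases h0 : l i = 0
        · rw [h0, zero_mul, zero_mul]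
        · exact mul_le_mul_of_nonneg_left (sum_norm_sq_marginal_le hr hψ hy hyp hK0 hK
            (hrange (hvr i h0)) (hv1 i) α) (hl i)
    _ = _ := by rw [← Finset.sum_mul, hl1, one_mul]

/-! ### The Wasserstein bound -/

/-- A logarithm needs full rank, so `A` is mixed with weight δ of σ^{⊗n}. Because K ≥ 1 the mixture
still lies below Kσ^{⊗n}, and undoing the mixing divides the costs by 1 - δ. -/
theorem exists_hasSiteCosts_of_posSemidef_sub {a : Type*} [Fintype a] [DecidableEq a] {n : ℕ}
    {σ : Matrix a a ℂ} (hσ : IsState σ) (hσ' : σ.PosDef) {A : Matrix (Fin n → a) (Fin n → a) ℂ}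
    (hA : IsState A) {K : ℝ} (hK : 1 ≤ K) (h : ((K : ℂ) • tensorPower n σ - A).PosSemidef)
    {δ : ℝ} (hδ : 0 < δ) (hδ1 : δ < 1) :
    ∃ c : Fin n → ℝ, HasSiteCosts c A (tensorPower n σ) ∧
      ∑ i, c i ≤ (1 - δ)⁻¹ * Real.sqrt (n * Real.log K / 2) := by
  obtain ⟨g, hg⟩ := hσ'.exists_isLog
  obtain ⟨G, hG, hcost⟩ := exists_hasSiteCosts_of_isLog hσ hg n
  set S := tensorPower n σ with hS
  have hSst : IsState S := hσ.tensorPower n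
  set A' := ((1 - δ : ℝ) : ℂ) • A + (δ : ℂ) • S with hA'
  have h1δ : 0 < 1 - δ := by linarith
  have hA'st : IsState A' := hA.convex_combination hSst h1δ.le hδ.le (by ring)
  have hA'pd : A'.PosDef :=
    (hG.posDef.smul (show (0 : ℂ) < δ by exact_mod_cast hδ)).posSemidef_add
      (hA.1.smul (by exact_mod_cast h1δ.le))
  have hA'K : ((K : ℂ) • S - A').PosSemidef := by
    have h1 : (K : ℂ) • S - A' = ((1 - δ : ℝ) : ℂ) • ((K : ℂ) • S - A) +
        ((δ * (K - 1) : ℝ) : ℂ) • S := by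
      rw [hA']
      push_cast
      module
    rw [h1]
    refine (h.smul (by exact_mod_cast h1δ.le)).add (hSst.1.smul ?_)
    exact_mod_cast mul_nonneg hδ.le (sub_nonneg.2 hK)
  obtain ⟨H, hH⟩ := hA'pd.exists_isLog
  obtain ⟨c, hc, hcs⟩ := hcost A' H hA'st hH
  have hlog := hH.trace_mul_sub_le_log hG hA'st.2 (by linarith) hA'K
  refine ⟨_, hc.smul (inv_nonneg.2 h1δ.le) (C := A) ?_, ?_⟩
  · have h1 : A' - S = ((1 - δ : ℝ) : ℂ) • (A - S) := by
      rw [hA']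
      push_cast
      module
    rw [h1, smul_smul, ← Complex.ofReal_mul, inv_mul_cancel₀ h1δ.ne', Complex.ofReal_one, one_smul]
  · rw [← Finset.mul_sum]
    refine mul_le_mul_of_nonneg_left (Real.le_sqrt_of_sq_le ?_) (inv_nonneg.2 h1δ.le)
    have h1 := sq_sum_le_card_mul_sum_sq (s := Finset.univ) (f := c)
    rw [Finset.card_univ, Fintype.card_fin] at h1
    calc (∑ i, c i) ^ 2 ≤ n * ∑ i, c i ^ 2 := h1
      _ ≤ n * (Real.log K / 2) := by gcongr; linarith
      _ = _ := by ring

/-! ### Choice of parameters and conclusion. -/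

theorem IsState.one_sub_posSemidef {a : Type*} [Fintype a] [DecidableEq a] {ρ : Matrix a a ℂ}
    (hρ : IsState ρ) : (1 - ρ).PosSemidef := by
  obtain ⟨U, hU, hU', hρU⟩ := hρ.1.isHermitian.exists_diagonalization
  set l := hρ.1.isHermitian.eigenvalues
  have hl : ∑ i, l i = 1 := by
    have := hρ.2
    rw [hρU, Matrix.trace_mul_comm, ← Matrix.mul_assoc, hU, Matrix.one_mul,
      Matrix.trace_diagonal] at this
    exact_mod_cast this
  have h1 : 1 - ρ = U * Matrix.diagonal (fun i => ((1 - l i : ℝ) : ℂ)) * U.conjTranspose := by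
    have h2 : Matrix.diagonal (fun i => ((1 - l i : ℝ) : ℂ)) =
        1 - Matrix.diagonal (fun i => (l i : ℂ)) := by
      rw [← Matrix.diagonal_one, Matrix.diagonal_sub]
      simp
    rw [h2, Matrix.mul_sub, Matrix.sub_mul, Matrix.mul_one, hU', ← hρU]
  rw [h1]
  refine Matrix.PosSemidef.mul_mul_conjTranspose_same (Matrix.posSemidef_diagonal_iff.2 ?_) _
  intro i
  have := Finset.single_le_sum (fun i _ => hρ.1.eigenvalues_nonneg i) (Finset.mem_univ i)
  rw [hl] at this
  exact_mod_cast sub_nonneg.2 this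

/-- From ln(1/t) ≥ 1 - t one gets h₂(x) ≥ 2x(1-x), and x ≥ 1 - x. -/
theorem two_mul_sq_le_binEntropy {x : ℝ} (hx : 1 / 2 ≤ x) (hx1 : x ≤ 1) :
    2 * (1 - x) ^ 2 ≤ Real.binEntropy x := by
  have h1 : 1 - x ≤ Real.log x⁻¹ := by
    rw [Real.log_inv]
    linarith [Real.log_le_sub_one_of_pos (show 0 < x by linarith)]
  have h2 : (1 - x) * x ≤ (1 - x) * Real.log (1 - x)⁻¹ := by
    rcases hx1.eq_or_lt with rfl | h
    · simp
    · rw [Real.log_inv]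
      refine mul_le_mul_of_nonneg_left ?_ (by linarith)
      linarith [Real.log_le_sub_one_of_pos (show 0 < 1 - x by linarith)]
  have h3 : x * (1 - x) ≤ x * Real.log x⁻¹ := mul_le_mul_of_nonneg_left h1 (by linarith)
  rw [Real.binEntropy]
  nlinarith

theorem log_inv_pow_mul_pow {n r : ℕ} (hn : 1 ≤ n) (hr : r ≤ n) {x D : ℝ} (hx : x = r / n)
    (hx0 : 0 < x) (hx1 : x < 1) (hD : 0 < D) :
    Real.log ((1 - x) ^ (n - r) * (x / D) ^ r)⁻¹ = n * (Real.binEntropy x + x * Real.log D) := by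
  have hn0 : (n : ℝ) ≠ 0 := by positivity
  have hnx : n * x = r := by rw [hx]; field_simp
  have hp : (1 - x) ≠ 0 := by linarith
  have hy : x / D ≠ 0 := by positivity
  rw [Real.log_inv, Real.log_mul (pow_ne_zero _ hp) (pow_ne_zero _ hy), Real.log_pow,
    Real.log_pow, Real.log_div hx0.ne' hD.ne', Real.binEntropy, Real.log_inv, Real.log_inv,
    Nat.cast_sub hr, ← hnx]
  ring

/-- The main estimate, for few defects. -/
theorem IsMSRAlmostIID.wassersteinDist_le {a : Type*} [Fintype a] [DecidableEq a] {n r : ℕ}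
    {ρ : Matrix a a ℂ} {ρn : Matrix (Fin n → a) (Fin n → a) ℂ} (h : IsMSRAlmostIID n r ρ ρn)
    (hρ : IsState ρ) (hρn : IsState ρn) (hn : 1 ≤ n) (hr0 : 1 ≤ r) (hd : 2 ≤ Fintype.card a)
    (hrd : (r : ℝ) / n * Fintype.card a ≤ Fintype.card a - 1) :
    wassersteinDist ρn (tensorPower n ρ) ≤
      n * (Real.sqrt ((Real.binEntropy ((r : ℝ) / n) +
        (r : ℝ) / n * Real.log ((Fintype.card a : ℝ) - 1)) / 2) + (r : ℝ) / n) := by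
  have hr : r ≤ n := h.1
  set d : ℝ := (Fintype.card a : ℝ) with hdd
  set x : ℝ := (r : ℝ) / n with hx
  have hd2 : 2 ≤ d := by rw [hdd]; exact_mod_cast hd
  have hn0 : (0 : ℝ) < n := by exact_mod_cast hn
  have hr0' : (0 : ℝ) < r := by exact_mod_cast hr0
  have hx0 : 0 < x := by positivity
  have hD : 0 < d - 1 := by linarith
  have hx1 : x < 1 := by nlinarith
  set y : ℝ := x / (d - 1) with hy
  have hy0 : 0 < y := by positivity
  have hyD : y * (d - 1) = x := by rw [hy]; field_simp
  have hyp : y ≤ 1 - x := by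
    rw [hy, div_le_iff₀ hD]
    linarith
  -- Since y ≤ 1 - x, the smallest of the eigenvalues with at most r defects is the one with exactly
  -- r.
  set K : ℝ := ((1 - x) ^ (n - r) * y ^ r)⁻¹ with hK
  have hp0 : 0 < 1 - x := by linarith
  have hKpos : 0 < (1 - x) ^ (n - r) * y ^ r := by positivity
  have hK1 : 1 ≤ K := by
    rw [hK]
    refine (one_le_inv₀ hKpos).2 (mul_le_one₀ ?_ (by positivity) ?_)
    · exact pow_le_one₀ hp0.le (by linarith)
    · exact pow_le_one₀ hy0.le (by linarith)
  have hKk : ∀ k ≤ r, 1 ≤ K * ((1 - x) ^ (n - k) * y ^ k) := by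
    intro k hk
    rw [hK, inv_mul_eq_div, one_le_div hKpos]
    have e1 : r = (r - k) + k := by omega
    have e2 : n - k = (n - r) + (r - k) := by omega
    rw [e2, pow_add, show y ^ r = y ^ (r - k) * y ^ k by rw [← pow_add, ← e1], ← mul_assoc]
    gcongr
  set σ : Matrix a a ℂ := (y : ℂ) • 1 + ((1 - x - y : ℝ) : ℂ) • ρ with hσ
  have hσpd : σ.PosDef :=
    (Matrix.PosDef.one.smul (show (0 : ℂ) < y by exact_mod_cast hy0)).add_posSemidef
      (hρ.1.smul (by exact_mod_cast sub_nonneg.2 hyp))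
  have hσst : IsState σ := by
    refine ⟨hσpd.posSemidef, ?_⟩
    rw [hσ, Matrix.trace_add, Matrix.trace_smul, Matrix.trace_smul, hρ.2, Matrix.trace_one]
    have : y * d + (1 - x - y) * 1 = 1 := by linarith
    simp only [smul_eq_mul]
    exact_mod_cast this
  set τ : Matrix a a ℂ := (((d - 1)⁻¹ : ℝ) : ℂ) • (1 - ρ) with hτ
  have hτst : IsState τ := by
    refine ⟨hρ.one_sub_posSemidef.smul (by exact_mod_cast (inv_pos.2 hD).le), ?_⟩
    rw [hτ, Matrix.trace_smul, Matrix.trace_sub, hρ.2, Matrix.trace_one, smul_eq_mul]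
    have hdc : (Fintype.card a : ℂ) = (d : ℂ) := by rw [hdd, Complex.ofReal_natCast]
    rw [hdc, ← Complex.ofReal_one, ← Complex.ofReal_sub, ← Complex.ofReal_mul,
      inv_mul_cancel₀ hD.ne']
  have hστ : σ - ρ = (x : ℂ) • (τ - ρ) := by
    have h1 : (x : ℂ) • τ = (y : ℂ) • (1 - ρ) := by
      rw [hτ, smul_smul, ← Complex.ofReal_mul, ← div_eq_mul_inv]
    rw [smul_sub, h1, hσ]
    push_cast
    module
  have hpsd := h.posSemidef_sub hρ.1.isHermitian hρn.1.isHermitian hy0.le hyp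
    (zero_le_one.trans hK1) hKk
  have hlog := log_inv_pow_mul_pow hn hr hx hx0 hx1 hD
  set f := Real.binEntropy x + x * Real.log (d - 1) with hf
  have hB : Real.sqrt (n * Real.log K / 2) = n * Real.sqrt (f / 2) := by
    rw [hK, hlog, show n * (n * f) / 2 = (n : ℝ) ^ 2 * (f / 2) by ring,
      Real.sqrt_mul (sq_nonneg _), Real.sqrt_sq hn0.le]
  have hδ : ∀ δ : ℝ, 0 < δ → δ < 1 → (1 - δ) * (wassersteinDist ρn (tensorPower n ρ) - n * x) ≤
      n * Real.sqrt (f / 2) := by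
    intro δ hδ0 hδ1
    obtain ⟨c, hc, hcs⟩ :=
      exists_hasSiteCosts_of_posSemidef_sub hσst hσpd hρn hK1 hpsd hδ0 hδ1
    have h1 := (hc.trans (hρ.hasSiteCosts_tensorPower hσst hτst hx0.le hστ n)).wassersteinDist_le
    rw [Finset.sum_add_distrib, Finset.sum_const, Finset.card_univ, Fintype.card_fin,
      nsmul_eq_mul] at h1
    rw [hB] at hcs
    have h1δ : 0 < 1 - δ := by linarith
    rw [← le_div_iff₀' h1δ, div_eq_inv_mul]
    linarith
  have hs := Real.sqrt_nonneg (f / 2)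
  set B := n * Real.sqrt (f / 2) with hBB
  have hB0 : 0 ≤ B := by positivity
  rw [mul_add, ← sub_le_iff_le_add]
  by_contra! hcon
  set D := wassersteinDist ρn (tensorPower n ρ) - n * x
  -- The limit δ → 0: if D > B, then δ = (D-B)/(2D) makes (1-δ)D = (D+B)/2 > B.
  have hD0 : 0 < D := lt_of_le_of_lt hB0 hcon
  have := hδ ((D - B) / (2 * D)) (div_pos (by linarith) (by linarith))
    ((div_lt_one (by linarith)).2 (by linarith))
  have h2 : (1 - (D - B) / (2 * D)) * D = (D + B) / 2 := by
    field_simp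
    ring
  linarith

theorem IsMSRAlmostIID.isWassersteinAlmostIID {a : Type*} [Fintype a] [DecidableEq a] {n r : ℕ}
    {ρ : Matrix a a ℂ} {ρn : Matrix (Fin n → a) (Fin n → a) ℂ} (h : IsMSRAlmostIID n r ρ ρn)
    (hρ : IsState ρ) (hρn : IsState ρn) (hn : 1 ≤ n) :
    IsWassersteinAlmostIID n
      (Real.sqrt ((Real.binEntropy ((r : ℝ) / n) +
        (r : ℝ) / n * Real.log ((Fintype.card a : ℝ) - 1)) / 2) + (r : ℝ) / n) ρ ρn := by
  have hr : r ≤ n := h.1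
  have hn0 : (0 : ℝ) < n := by exact_mod_cast hn
  have hx0 : 0 ≤ (r : ℝ) / n := by positivity
  have hx1 : (r : ℝ) / n ≤ 1 := (div_le_one hn0).2 (by exact_mod_cast hr)
  rw [IsWassersteinAlmostIID]
  have of_eq : ρn = tensorPower n ρ → 1 / (n : ℝ) * wassersteinDist ρn (tensorPower n ρ) ≤
      Real.sqrt ((Real.binEntropy ((r : ℝ) / n) +
        (r : ℝ) / n * Real.log ((Fintype.card a : ℝ) - 1)) / 2) + (r : ℝ) / n := by
    intro heq
    have h1 := (HasSiteCosts.refl hρn heq).wassersteinDist_le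
    rw [Finset.sum_const_zero] at h1
    have h2 : 1 / (n : ℝ) * wassersteinDist ρn (tensorPower n ρ) ≤ 0 :=
      mul_nonpos_of_nonneg_of_nonpos (by positivity) h1
    exact h2.trans (add_nonneg (Real.sqrt_nonneg _) hx0)
  -- On a one-dimensional space there is only one state.
  rcases le_or_gt (Fintype.card a) 1 with hd | hd
  · have := Fintype.card_le_one_iff_subsingleton.1 hd
    exact of_eq (hρn.eq_of_subsingleton (hρ.tensorPower n))
  rcases Nat.eq_zero_or_pos r with rfl | hr0
  · refine of_eq ?_
    -- Without defects y = 0 and K = 1 are allowed: ρ_n ≤ ρ^{⊗n} with equal traces forces equality.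
    have hpsd := h.posSemidef_sub hρ.1.isHermitian hρn.1.isHermitian (p := 1) (y := 0) (K := 1)
      le_rfl zero_le_one zero_le_one (by
        intro k hk
        obtain rfl := Nat.le_zero.1 hk
        simp)
    simp only [Complex.ofReal_zero, zero_smul, zero_add, sub_zero, Complex.ofReal_one,
      one_smul] at hpsd
    have h1 := hpsd.trace_eq_zero_iff.1 (by
      rw [Matrix.trace_sub, hρn.2, (hρ.tensorPower n).2, sub_self])
    exact (sub_eq_zero.1 h1).symm
  have hd' : (2 : ℝ) ≤ Fintype.card a := by exact_mod_cast hd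
  rcases le_or_gt ((r : ℝ) / n * Fintype.card a) (Fintype.card a - 1) with hrd | hrd
  · have h1 := h.wassersteinDist_le hρ hρn hn hr0 hd hrd
    rw [one_div_mul_eq_div, div_le_iff₀' hn0]
    exact h1
  · set x : ℝ := (r : ℝ) / n
    -- Here x > 1 - 1/d ≥ 1/2, and the trivial bound 1 on the normalised distance is enough.
    have hx2 : 1 / 2 ≤ x := by
      by_contra! hcon
      nlinarith
    have h1 := (hρ.hasSiteCosts_one hρn).wassersteinDist_le
    rw [Finset.sum_const, Finset.card_univ, Fintype.card_fin, nsmul_eq_mul, mul_one] at h1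
    have h2 : 1 / (n : ℝ) * wassersteinDist ρn (tensorPower n ρ) ≤ 1 := by
      rw [one_div_mul_eq_div]
      exact (div_le_one hn0).2 h1
    have h3 := two_mul_sq_le_binEntropy hx2 hx1
    have h4 : 0 ≤ x * Real.log ((Fintype.card a : ℝ) - 1) :=
      mul_nonneg hx0 (Real.log_nonneg (by linarith))
    have h5 : 1 - x ≤ Real.sqrt ((Real.binEntropy x +
        x * Real.log ((Fintype.card a : ℝ) - 1)) / 2) :=
      Real.le_sqrt_of_sq_le (by linarith)
    linarith

theorem mainTheorem1 {a : Type*} [Fintype a] [DecidableEq a] (ρ : Matrix a a ℂ)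
    (hρ : IsState ρ) :
    (∀ (n r : ℕ) (ρn : Matrix (Fin n → a) (Fin n → a) ℂ), 1 ≤ n → IsState ρn →
      IsMSRAlmostIID n r ρ ρn →
      IsWassersteinAlmostIID n
        (Real.sqrt ((Real.binEntropy ((r : ℝ) / n) +
          (r : ℝ) / n * Real.log ((Fintype.card a : ℝ) - 1)) / 2) + (r : ℝ) / n) ρ ρn) ∧
    (∀ ρs : ∀ n : ℕ, Matrix (Fin n → a) (Fin n → a) ℂ, (∀ n : ℕ, 1 ≤ n → IsState (ρs n)) →
      IsMSRSource ρ ρs → IsWassersteinSource ρ ρs) := by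
  refine ⟨fun n r ρn hn hρn h => h.isWassersteinAlmostIID hρ hρn hn, ?_⟩
  rintro ρs hρs ⟨r, hr, hmsr⟩
  have hx : Filter.Tendsto (fun n : ℕ => (r n : ℝ) / n) Filter.atTop (nhds 0) :=
    hr.tendsto_div_nhds_zero
  -- For d = 1 the convention `Real.log 0 = 0` makes the logarithmic term vanish, as the statement
  -- requires.
  have hcont : Continuous fun x : ℝ => Real.sqrt ((Real.binEntropy x +
      x * Real.log ((Fintype.card a : ℝ) - 1)) / 2) + x := by
    have := Real.binEntropy_continuous
    fun_prop
  have hlim := (hcont.tendsto 0).comp hx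
  simp only [Real.binEntropy_zero, zero_mul, add_zero, zero_div, Real.sqrt_zero] at hlim
  refine tendsto_of_tendsto_of_tendsto_of_le_of_le' tendsto_const_nhds hlim
    (Filter.Eventually.of_forall fun n => mul_nonneg (by positivity) (wassersteinDist_nonneg _ _)) ?_
  filter_upwards [Filter.eventually_ge_atTop 1] with n hn
  exact (hmsr n hn).isWassersteinAlmostIID hρ (hρs n hn) hn
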